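/- For graphs $H_1,H_2$, the Ramsey number $r(H_1,H_2)$ is the least $N$ such that for every graph $G$ on $N$ vertices, either $G$ contains a copy of $H_1$ or its complement $\overline G$ contains a copy of $H_2$ (copies need not be induced). Let $K_p(a_1,\dots,a_p)$ be the complete $p$-partite graph with parts of sizes $a_1,\dots,a_p$, and let $B_{k,n}$ be the book graph on $n$ vertices consisting of $n-k$ copies of $K_{k+1}$ that share a common $K_k$. There is an absolute constant $h$ such that for all integers $k,p,t\ge 2$ there exists $\delta>0$, with $1/\delta$ at most the $h$-fold iterated exponential (base $2$) of $k+p+t$ (so $1/\delta$ is not of tower type), for which the following holds for all sufficiently large $n$ (in terms of $k,p,t$). Let $a_1,\dots,a_p$ be positive integers with $1=a_1\le a_2\le\dots\le a_{p-1}\le t$ and $a_p\le\delta n$. Then $$r\bigl(K_p(a_1,\dots,a_p),B_{k,n}\bigr)\le (p-1)(n-1)+k(p-1)(a_2-1)+1 .$$ Moreover, if $a_2\le a_p$ and $a_2$ divides $n-1-k$, then equality holds. -/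

import Mathlib

/-- The book graph `B_{k,n}` on `n` vertices (meant for `k ≤ n`): the first `k` vertices form a
clique (the spine), each of the other `n - k` vertices is adjacent to exactly the `k` spine
vertices. So it consists of `n - k` copies of `K_{k+1}` sharing a common `K_k`. -/
def bookGraph (k n : ℕ) : SimpleGraph (Fin n) where
  Adj i j := i ≠ j ∧ ((i : ℕ) < k ∨ (j : ℕ) < k)
  symm := ⟨fun _ _ h => ⟨h.1.symm, h.2.symm⟩⟩
  loopless := ⟨fun _ h => h.1 rfl⟩

/-- The complete `p`-partite graph `K_p(a_1, …, a_p)` with parts of sizes `a 1, …, a p`. -/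
abbrev completePartite (p : ℕ) (a : ℕ → ℕ) :
    SimpleGraph (Σ i : Fin p, Fin (a ((i : ℕ) + 1))) :=
  SimpleGraph.completeMultipartiteGraph (fun i : Fin p => Fin (a ((i : ℕ) + 1)))

/-- Every graph `G` on `N` vertices contains a (not necessarily induced) copy of `H₁`, or its
complement contains a copy of `H₂`. -/
def RamseyArrow {V W : Type*} (H₁ : SimpleGraph V) (H₂ : SimpleGraph W) (N : ℕ) : Prop :=
  ∀ G : SimpleGraph (Fin N), H₁.IsContained G ∨ H₂.IsContained Gᶜ

/-- The Ramsey number `r(H₁, H₂)`: the least `N` with `RamseyArrow H₁ H₂ N`. It takes values in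
`ℕ∞`, and is `⊤` if there is no such `N`; thus an upper bound by a natural number includes the
existence of such an `N`. -/
noncomputable def ramseyNumber {V W : Type*} (H₁ : SimpleGraph V) (H₂ : SimpleGraph W) : ℕ∞ :=
  ⨅ N ∈ {N : ℕ | RamseyArrow H₁ H₂ N}, (N : ℕ∞)

/-- The `h`-fold iterated exponential `2 ^ (2 ^ (⋯ ^ (2 ^ m)))`, with `h` twos. -/
def iteratedExp : ℕ → ℕ → ℕ
  | 0, m => m
  | h + 1, m => 2 ^ iteratedExp h m

/-! Put q = p - 1, and suppose that a graph G on one vertex more than q(n - 1 - k + k a_2) has no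
`K_p(a)` while its complement has no book. Excluding `K_p(a)` forces every set that is large
compared with a_p to contain a large stable set. Excluding the book forces, on average over the
k-subsets of a stable set Q, fewer than n common nonneighbours; so only about n vertices can be
almost nonadjacent to Q.

Since G has about qn vertices, these two facts yield q pairwise joined stable sets of a fixed size
(`exists_joined_stable_family`), and these split almost all of G into q clusters of about n
vertices, according to the stable set to which a vertex is nearly nonadjacent. Covering each cluster
by stable sets and discarding atypical vertices gives sets W_0, …, W_{q-1}, each of at least n/8
vertices, with almost all edges present between different ones
(`Params.exists_almost_joined_family`). Only greedy choices, pigeonhole and averaging are used, no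
regularity lemma, so the constants are bounded by a fixed number of exponentials.

The sharp bound comes from one averaging argument (`AlmostJoined.card_add_le`). Let Y_i be the
vertices joined to almost all of each W_j with j ≠ i. Because a_1 = 1, degrees inside Y_i are below
a_2, so a stable k-set K in W_i has at least |Y_i| - k a_2 common nonneighbours in Y_i outside K,
and the missing book leaves room for at most n - k - 1 - |Y_i| + k a_2 others. A vertex z in no Y_i
is nonadjacent to nearly all k-sets of some W_i and to a positive proportion of those of some other
W_j; the constants make the proportions add up to at least 1. Summing over i gives |V| ≤ q(n - 1 - k
+ k a_2), a contradiction.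

For equality, take q blocks of n - 1 - k + k a_2 vertices, each a disjoint union of cliques on a_2
vertices, with all edges between blocks. -/

namespace BookRamsey

open Finset
open scoped Classical

/-! ### Stable sets, greedy embedding and pigeonhole on neighbourhoods -/

section Basic

variable {V : Type*}

/-- Every vertex of `S` is adjacent to every vertex of `U`. -/
def Joined (G : SimpleGraph V) (S U : Finset V) : Prop :=
  ∀ x ∈ S, ∀ y ∈ U, G.Adj x y

/-- No two vertices of `K` are adjacent. -/
def Stable (G : SimpleGraph V) (K : Finset V) : Prop :=
  ∀ x ∈ K, ∀ y ∈ K, ¬ G.Adj x y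

/-- The vertices of `Q` that are not adjacent to `u` (among them `u` itself, if it is in `Q`). -/
noncomputable def nonNbrs (G : SimpleGraph V) (Q : Finset V) (u : V) : Finset V :=
  Q.filter fun x => ¬ G.Adj u x

/-- The neighbours of `u` in `Q`. -/
noncomputable def nbrs (G : SimpleGraph V) (Q : Finset V) (u : V) : Finset V :=
  Q.filter fun x => G.Adj u x

/-- The stable subsets of `X` of size `k`. -/
noncomputable def stableSets (G : SimpleGraph V) (k : ℕ) (X : Finset V) : Finset (Finset V) :=
  (X.powersetCard k).filter fun K => Stable G K

variable {G : SimpleGraph V}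

theorem Joined.symm {S U : Finset V} (h : Joined G S U) : Joined G U S :=
  fun x hx y hy => (h y hy x hx).symm

theorem Joined.mono {S S' U U' : Finset V} (h : Joined G S U) (hS : S' ⊆ S) (hU : U' ⊆ U) :
    Joined G S' U' :=
  fun x hx y hy => h x (hS hx) y (hU hy)

theorem Stable.mono {K K' : Finset V} (h : Stable G K) (hK : K' ⊆ K) : Stable G K' :=
  fun x hx y hy => h x (hK hx) y (hK hy)

theorem mem_nonNbrs {Q : Finset V} {u x : V} : x ∈ nonNbrs G Q u ↔ x ∈ Q ∧ ¬ G.Adj u x :=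
  mem_filter

theorem mem_nbrs {Q : Finset V} {u x : V} : x ∈ nbrs G Q u ↔ x ∈ Q ∧ G.Adj u x :=
  mem_filter

theorem mem_stableSets {k : ℕ} {X K : Finset V} :
    K ∈ stableSets G k X ↔ K ⊆ X ∧ #K = k ∧ Stable G K := by
  simp [stableSets, mem_powersetCard, and_assoc]

theorem nbrs_subset {Q : Finset V} {u : V} : nbrs G Q u ⊆ Q := filter_subset _ _

theorem nonNbrs_subset {Q : Finset V} {u : V} : nonNbrs G Q u ⊆ Q := filter_subset _ _

theorem nonNbrs_mono {Q Q' : Finset V} (h : Q ⊆ Q') (u : V) : nonNbrs G Q u ⊆ nonNbrs G Q' u :=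
  filter_subset_filter _ h

theorem card_nbrs_add_card_nonNbrs (Q : Finset V) (u : V) :
    #(nbrs G Q u) + #(nonNbrs G Q u) = #Q :=
  card_filter_add_card_filter_not _

/-- The vertices of `Q` that are adjacent to all of `S`: at most `#S * d` are lost if every vertex
of `S` has at most `d` nonneighbours in `Q`. -/
theorem card_le_card_common_nbrs {Q S : Finset V} {d : ℕ} (h : ∀ x ∈ S, #(nonNbrs G Q x) ≤ d) :
    #Q ≤ #(Q.filter fun y => ∀ x ∈ S, G.Adj x y) + #S * d := by
  have h1 : Q ⊆ (Q.filter fun y => ∀ x ∈ S, G.Adj x y) ∪ S.biUnion fun x => nonNbrs G Q x := by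
    intro y hy
    by_cases hc : ∀ x ∈ S, G.Adj x y
    · exact mem_union_left _ (mem_filter.2 ⟨hy, hc⟩)
    · push Not at hc
      obtain ⟨x, hx, hxy⟩ := hc
      exact mem_union_right _ (mem_biUnion.2 ⟨x, hx, mem_nonNbrs.2 ⟨hy, hxy⟩⟩)
  calc #Q ≤ _ := card_le_card h1
    _ ≤ _ := card_union_le _ _
    _ ≤ _ := by gcongr; exact card_biUnion_le_card_mul _ _ _ h

/-- Double counting of inclusions K ⊆ K': a vertex extends K unless it lies in one of k closed
neighbourhoods, each of at most d vertices, and K' has only k + 1 subsets of size k. -/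
theorem card_stableSets_mul_le {X : Finset V} {d : ℕ} (hd : ∀ x ∈ X, #(nbrs G X x) < d) (k : ℕ) :
    #(stableSets G k X) * (#X - k * d) ≤ #(stableSets G (k + 1) X) * (k + 1) := by
  refine card_mul_le_card_mul (fun K K' => K ⊆ K') (fun K hK => ?_) (fun K' hK' => ?_)
  · obtain ⟨hKX, hKc, hKs⟩ := mem_stableSets.1 hK
    have h1 : X ⊆ (X.filter fun y => y ∉ K ∧ ∀ x ∈ K, ¬ G.Adj x y) ∪
        K.biUnion fun x => insert x (nbrs G X x) := by
      intro y hy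
      by_cases hc : y ∉ K ∧ ∀ x ∈ K, ¬ G.Adj x y
      · exact mem_union_left _ (mem_filter.2 ⟨hy, hc⟩)
      · refine mem_union_right _ (mem_biUnion.2 ?_)
        by_cases hyK : y ∈ K
        · exact ⟨y, hyK, mem_insert_self _ _⟩
        · have : ∃ x ∈ K, G.Adj x y := by
            by_contra hcc
            push Not at hcc
            exact hc ⟨hyK, hcc⟩
          obtain ⟨x, hx, hxy⟩ := this
          exact ⟨x, hx, mem_insert_of_mem (mem_nbrs.2 ⟨hy, hxy⟩)⟩
    have h2 : #X ≤ #(X.filter fun y => y ∉ K ∧ ∀ x ∈ K, ¬ G.Adj x y) + k * d := by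
      calc #X ≤ _ := card_le_card h1
        _ ≤ _ := card_union_le _ _
        _ ≤ _ := by
          rw [← hKc]
          gcongr
          refine card_biUnion_le_card_mul _ _ _ fun x hx => ?_
          exact (card_insert_le _ _).trans (hd x (hKX hx))
    refine (Nat.sub_le_iff_le_add.2 h2).trans ?_
    refine card_le_card_of_injOn (fun y => insert y K) (fun y hy => ?_) ?_
    · obtain ⟨hyX, hyK, hyn⟩ := mem_filter.1 (mem_coe.1 hy)
      simp only [coe_filter, Set.mem_ofPred_eq, bipartiteAbove]
      refine ⟨mem_stableSets.2 ⟨insert_subset hyX hKX, by rw [card_insert_of_notMem hyK, hKc], ?_⟩,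
        subset_insert _ _⟩
      intro a ha b hb hab
      rcases mem_insert.1 ha with ha' | ha' <;> rcases mem_insert.1 hb with hb' | hb'
      · exact G.loopless.irrefl _ (ha' ▸ hb' ▸ hab)
      · exact hyn b hb' (ha' ▸ hab.symm)
      · exact hyn a ha' (hb' ▸ hab)
      · exact hKs a ha' b hb' hab
    · intro y hy z hz hyz
      have hyK := (mem_filter.1 (mem_coe.1 hy)).2.1
      have : y ∈ insert z K := by
        rw [← show insert y K = insert z K from hyz]; exact mem_insert_self _ _
      rcases mem_insert.1 this with h | h
      · exact h
      · exact absurd h hyK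
  · obtain ⟨-, hc, -⟩ := mem_stableSets.1 hK'
    have : bipartiteBelow (fun K K' => K ⊆ K') (stableSets G k X) K' ⊆ K'.powersetCard k := by
      intro K hK
      obtain ⟨hK, hKK⟩ := mem_filter.1 hK
      exact mem_powersetCard.2 ⟨hKK, (mem_stableSets.1 hK).2.1⟩
    refine (card_le_card this).trans ?_
    rw [card_powersetCard, hc, Nat.choose_succ_self_right]

/-- A graph of small maximum degree has many stable sets of a given size. -/
theorem pow_le_factorial_mul_card_stableSets {X : Finset V} {d : ℕ}
    (hd : ∀ x ∈ X, #(nbrs G X x) < d) (k : ℕ) :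
    (#X - k * d) ^ k ≤ k.factorial * #(stableSets G k X) := by
  have key : ∀ j ≤ k, (#X - k * d) ^ j ≤ j.factorial * #(stableSets G j X) := by
    intro j
    induction j with
    | zero =>
      intro _
      have : (∅ : Finset V) ∈ stableSets G 0 X :=
        mem_stableSets.2 ⟨empty_subset _, rfl, fun x hx => absurd hx (notMem_empty _)⟩
      simpa using card_pos.2 ⟨_, this⟩
    | succ j ih =>
      intro hj
      calc (#X - k * d) ^ (j + 1) = (#X - k * d) ^ j * (#X - k * d) := pow_succ _ _
        _ ≤ (j.factorial * #(stableSets G j X)) * (#X - j * d) := by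
          gcongr
          · exact ih (by omega)
          · omega
        _ = j.factorial * (#(stableSets G j X) * (#X - j * d)) := by ring
        _ ≤ j.factorial * (#(stableSets G (j + 1) X) * (j + 1)) := by
          exact Nat.mul_le_mul_left _ (card_stableSets_mul_le hd j)
        _ = _ := by rw [Nat.factorial_succ]; ring
  exact key k le_rfl

theorem factorial_mul_card_stableSets_le (k : ℕ) (X : Finset V) :
    k.factorial * #(stableSets G k X) ≤ #X ^ k := by
  calc k.factorial * #(stableSets G k X) ≤ k.factorial * #(X.powersetCard k) := by
        gcongr; exact filter_subset _ _
    _ = (#X).descFactorial k := by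
        rw [card_powersetCard, Nat.descFactorial_eq_factorial_mul_choose]
    _ ≤ _ := Nat.descFactorial_le_pow _ _

theorem stableSets_nonempty {X : Finset V} {d : ℕ} (hd : ∀ x ∈ X, #(nbrs G X x) < d) {k : ℕ}
    (h : k * d < #X) : (stableSets G k X).Nonempty := by
  have := pow_le_factorial_mul_card_stableSets hd k
  have h2 : 0 < (#X - k * d) ^ k := by apply Nat.pow_pos; omega
  exact card_pos.1 (Nat.pos_of_mul_pos_left (h2.trans_le this))

/-- A large set without stable `T`-sets contains an `m`-set joined to a large set. -/
theorem exists_joined_of_no_stable {T x : ℕ} (hx : 0 < x) (m : ℕ) (U : Finset V)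
    (hU : ∀ K ⊆ U, #K = T → ¬ Stable G K) (hc : (T + 1) ^ m * x ≤ #U) :
    ∃ C ⊆ U, ∃ U' ⊆ U, #C = m ∧ x ≤ #U' ∧ Joined G C U' := by
  induction m generalizing U with
  | zero =>
    exact ⟨∅, empty_subset _, U, Subset.rfl, rfl, by simpa using hc,
      fun x hx => absurd hx (notMem_empty _)⟩
  | succ m ih =>
    -- If all degrees in U were below d, more than T * d vertices would give a stable T-set. So some
    -- vertex has d neighbours, and the induction continues among them.
    set d := (T + 1) ^ m * x with hd
    have hdpos : 0 < d := by positivity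
    have hTd : T * d < #U := by
      have : (T + 1) ^ (m + 1) * x = T * d + d := by rw [hd]; ring
      omega
    have : ∃ v ∈ U, d ≤ #(nbrs G U v) := by
      by_contra hcon
      push Not at hcon
      obtain ⟨K, hK⟩ := stableSets_nonempty hcon hTd
      obtain ⟨h1, h2, h3⟩ := mem_stableSets.1 hK
      exact hU K h1 h2 h3
    obtain ⟨v, hvU, hv⟩ := this
    obtain ⟨C, hCU, U', hU', hCm, hxU, hj⟩ :=
      ih (nbrs G U v) (fun K hK => hU K (hK.trans nbrs_subset)) hv
    have hvC : v ∉ C := fun h => G.loopless.irrefl _ (mem_nbrs.1 (hCU h)).2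
    refine ⟨insert v C, insert_subset hvU (hCU.trans nbrs_subset), U', hU'.trans nbrs_subset,
      by rw [card_insert_of_notMem hvC, hCm], hxU, fun a ha b hb => ?_⟩
    rcases mem_insert.1 ha with rfl | ha
    · exact (mem_nbrs.1 (hU' hb)).2
    · exact hj a ha b hb

/-- A large set without stable `T`-sets contains `t`-sets `S 0, …, S (r - 1)` and a large set that
are pairwise joined. -/
theorem exists_joined_family_of_no_stable {T t x : ℕ} (hx : 0 < x) (r : ℕ) (U : Finset V)
    (hU : ∀ K ⊆ U, #K = T → ¬ Stable G K) (hc : (T + 1) ^ (r * t) * x ≤ #U) :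
    ∃ S : ℕ → Finset V, ∃ U' ⊆ U, (∀ i < r, #(S i) = t) ∧
      (∀ i j, i < j → j < r → Joined G (S i) (S j)) ∧ (∀ i < r, Joined G (S i) U') ∧ x ≤ #U' := by
  induction r generalizing x with
  | zero => exact ⟨fun _ => ∅, U, Subset.rfl, by simp, by simp, by simp, by simpa using hc⟩
  | succ r ih =>
    obtain ⟨S, U', hU', h1, h2, h3, h4⟩ := ih (x := (T + 1) ^ t * x) (by positivity) (by
      rw [← mul_assoc, ← pow_add]; convert hc using 3; ring)
    obtain ⟨C, hC, U'', hU'', h5, h6, h7⟩ :=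
      exists_joined_of_no_stable hx t U' (fun K hK => hU K (hK.trans hU')) h4
    refine ⟨fun i => if i < r then S i else C, U'', hU''.trans hU', ?_, ?_, ?_, h6⟩
    · intro i _
      dsimp only
      split_ifs with h
      · exact h1 i h
      · exact h5
    · intro i j hij hj
      dsimp only
      rw [if_pos (by omega)]
      split_ifs with h
      · exact h2 i j hij h
      · exact (h3 i (by omega)).mono Subset.rfl hC
    · intro i _
      dsimp only
      split_ifs with h
      · exact (h3 i h).mono Subset.rfl hU''
      · exact h7

/-- Many vertices of `U` have the same neighbours in `P`. -/
theorem exists_same_nbrs (P U : Finset V) (hU : U.Nonempty) {m : ℕ} (hP : #P ≤ m) :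
    ∃ U' ⊆ U, U'.Nonempty ∧ #U ≤ 2 ^ m * #U' ∧
      ∀ u ∈ U', ∀ v ∈ U', nbrs G P u = nbrs G P v := by
  have hmaps : ∀ u ∈ U, nbrs G P u ∈ P.powerset := fun u _ => mem_powerset.2 nbrs_subset
  obtain ⟨R, -, hR⟩ := exists_max_image P.powerset
    (fun R => #(U.filter fun u => nbrs G P u = R)) ⟨∅, empty_mem_powerset _⟩
  have hsum := card_eq_sum_card_fiberwise (f := fun u => nbrs G P u) (s := U) (t := P.powerset)
    (fun u hu => hmaps u hu)
  have hle : #U ≤ 2 ^ m * #(U.filter fun u => nbrs G P u = R) := by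
    calc #U = _ := hsum
      _ ≤ #P.powerset • #(U.filter fun u => nbrs G P u = R) := sum_le_card_nsmul _ _ _ hR
      _ ≤ _ := by
        rw [smul_eq_mul, card_powerset]
        gcongr
        norm_num
  refine ⟨U.filter fun u => nbrs G P u = R, filter_subset _ _, ?_, hle, fun u hu v hv => ?_⟩
  · rw [← card_pos]
    have := card_pos.2 hU
    exact Nat.pos_of_mul_pos_left (this.trans_le hle)
  · rw [(mem_filter.1 hu).2, (mem_filter.1 hv).2]

/-- Greedy choice of pairwise joined sets of sizes `b 0, …, b (r - 1)`, the last of which may be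
large, from sets between which almost all edges are present. -/
theorem exists_joined_family_of_few_nonNbrs {r t : ℕ} {X : ℕ → Finset V} {b : ℕ → ℕ}
    (hb : ∀ i, i + 1 < r → b i ≤ t) (hX : ∀ i < r, 2 * b i ≤ #(X i))
    (hn : ∀ i j, i < j → j < r → ∀ x ∈ X i, 2 * r * t * #(nonNbrs G (X j) x) ≤ #(X j)) :
    ∃ S : ℕ → Finset V, (∀ i < r, S i ⊆ X i ∧ #(S i) = b i) ∧
      ∀ i j, i < j → j < r → Joined G (S i) (S j) := by
  have key : ∀ r' ≤ r, ∃ S : ℕ → Finset V, (∀ i < r', S i ⊆ X i ∧ #(S i) = b i) ∧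
      ∀ i j, i < j → j < r' → Joined G (S i) (S j) := by
    intro r'
    induction r' with
    | zero => exact fun _ => ⟨fun _ => ∅, by simp, by simp⟩
    | succ r' ih =>
      intro hr
      obtain ⟨S, h1, h2⟩ := ih (by omega)
      set P := (range r').biUnion S with hP
      have hPc : #P ≤ r' * t := by
        have := card_biUnion_le_card_mul (range r') S t (fun i hi => by
          have hi := mem_range.1 hi
          rw [(h1 i hi).2]; exact hb i (by omega))
        simpa using this
      have hPn : ∀ x ∈ P, 2 * r * t * #(nonNbrs G (X r') x) ≤ #(X r') := by
        intro x hx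
        obtain ⟨i, hi, hxi⟩ := mem_biUnion.1 hx
        have hi := mem_range.1 hi
        exact hn i r' hi (by omega) x ((h1 i hi).1 hxi)
      have hcard : b r' ≤ #((X r').filter fun y => ∀ x ∈ P, G.Adj x y) := by
        rcases Nat.eq_zero_or_pos (r' * t) with h0 | h0
        · have hP0 : P = ∅ := card_eq_zero.1 (by omega)
          have := hX r' (by omega)
          simp only [hP0, notMem_empty, false_imp_iff, implies_true, filter_true]
          omega
        · have hrt : r' * t ≤ r * t := Nat.mul_le_mul_right _ (by omega)
          have h3 := card_le_card_common_nbrs (G := G) (Q := X r') (S := P)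
            (d := #(X r') / (2 * r * t)) (fun x hx => by
              rw [Nat.le_div_iff_mul_le (by rw [mul_assoc]; omega), mul_comm]; exact hPn x hx)
          -- All earlier choices together cost at most half of the next set, which is why twice the
          -- required size suffices.
          have h4 : #P * (#(X r') / (2 * r * t)) ≤ #(X r') / 2 := by
            calc #P * (#(X r') / (2 * r * t)) ≤ (r * t) * (#(X r') / (2 * r * t)) := by
                  gcongr; omega
              _ = (r * t) * (#(X r') / 2 / (r * t)) := by
                rw [Nat.div_div_eq_div_mul, mul_assoc 2 r t]
              _ ≤ _ := Nat.mul_div_le _ _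
          have := hX r' (by omega)
          omega
      obtain ⟨C, hC, hCc⟩ := exists_subset_card_eq hcard
      refine ⟨fun i => if i < r' then S i else C, fun i hi => ?_, fun i j hij hj => ?_⟩
      · dsimp only
        split_ifs with h
        · exact h1 i h
        · obtain rfl : i = r' := by omega
          exact ⟨hC.trans (filter_subset _ _), hCc⟩
      · dsimp only
        rw [if_pos (by omega)]
        split_ifs with h
        · exact h2 i j hij h
        · intro x hx y hy
          exact (mem_filter.1 (hC hy)).2 x (mem_biUnion.2 ⟨i, mem_range.2 (by omega), hx⟩)
  exact key r le_rfl

end Basic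

/-! ### Consequences of excluding the multipartite graph -/

section NoJoined

variable {V : Type*}

/-- There are no pairwise joined sets, `q` of them of size `t` and a further one of size `b`. -/
def NoJoined (G : SimpleGraph V) (q t b : ℕ) : Prop :=
  ∀ (S : ℕ → Finset V) (U : Finset V), (∀ i < q, t ≤ #(S i)) →
    (∀ i j, i < j → j < q → Joined G (S i) (S j)) → (∀ i < q, Joined G (S i) U) → #U < b

variable {G : SimpleGraph V} {q t b : ℕ}

theorem NoJoined.exists_stable (h : NoJoined G q t b) (hb : 0 < b) {T : ℕ} {U : Finset V}
    (hU : (T + 1) ^ (q * t) * b ≤ #U) : ∃ K ⊆ U, #K = T ∧ Stable G K := by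
  by_contra hcon
  push Not at hcon
  obtain ⟨S, U', -, h1, h2, h3, h4⟩ := exists_joined_family_of_no_stable hb q U hcon hU
  exact absurd (h S U' (fun i hi => (h1 i hi).ge) h2 h3) (not_lt.2 h4)

/-- There are at most 2 ^ (q * T) possible neighbourhoods in the union of the `P i`. All vertices of
a largest class are joined to the sets `S i` of any one of them, so the class has fewer than b
vertices. -/
theorem NoJoined.card_le (h : NoJoined G q t b) {P : ℕ → Finset V} {U : Finset V} {T : ℕ}
    (hP : ∀ i < q, #(P i) ≤ T)
    (hU : ∀ u ∈ U, ∃ S : ℕ → Finset V, (∀ i < q, S i ⊆ nbrs G (P i) u ∧ t ≤ #(S i)) ∧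
      ∀ i j, i < j → j < q → Joined G (S i) (S j)) :
    #U ≤ 2 ^ (q * T) * b := by
  rcases U.eq_empty_or_nonempty with rfl | hne
  · simp
  have hPc : #((range q).biUnion P) ≤ q * T := by
    simpa using card_biUnion_le_card_mul (range q) P T fun i hi => hP i (mem_range.1 hi)
  obtain ⟨U', hU'U, ⟨u, hu⟩, hle, hsame⟩ := exists_same_nbrs (G := G) _ U hne hPc
  obtain ⟨S, hS, hSS⟩ := hU u (hU'U hu)
  have hlt := h S U' (fun i hi => (hS i hi).2) hSS (fun i hi x hx v hv => by
    obtain ⟨hxP, hxu⟩ := mem_nbrs.1 ((hS i hi).1 hx)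
    have : x ∈ nbrs G ((range q).biUnion P) u :=
      mem_nbrs.2 ⟨mem_biUnion.2 ⟨i, mem_range.2 hi, hxP⟩, hxu⟩
    rw [hsame u hu v hv] at this
    exact (mem_nbrs.1 this).2.symm)
  exact hle.trans (Nat.mul_le_mul_left _ hlt.le)

end NoJoined

/-! ### Consequences of excluding the book; pairwise joined stable sets -/

section Forbidden

variable {V : Type*} [Fintype V]

/-- No stable `k`-set has `n - k` further vertices that are nonadjacent to all of it: there is no
book on `n` vertices with a spine of size `k` in the complement. -/
def NoBook (G : SimpleGraph V) (k n : ℕ) : Prop :=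
  ∀ K : Finset V, #K = k → Stable G K →
    #(univ.filter fun u => u ∉ K ∧ ∀ x ∈ K, ¬ G.Adj u x) + k < n

variable {G : SimpleGraph V} {k n q t b : ℕ}

/-- Double counting of pairs of a k-subset of Q and a vertex outside it with no edge to it: each
k-subset is a possible spine, hence lies in fewer than n pairs. -/
theorem NoBook.sum_nonNbrs_pow_le (h : NoBook G k n) {Q : Finset V} (hQ : Stable G Q) :
    ∑ u, (#(nonNbrs G Q u) - k) ^ k ≤ #Q ^ k * n := by
  -- Subtracting k absorbs both the passage from falling factorial to power and the loss of u itself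
  -- when it lies in Q.
  have h1 : ∀ u : V, (#(nonNbrs G Q u) - k) ^ k ≤
      k.factorial * #((Q.powersetCard k).filter fun K => u ∉ K ∧ ∀ x ∈ K, ¬ G.Adj u x) := by
    intro u
    have hsub : nonNbrs G Q u ⊆ insert u ((nonNbrs G Q u).erase u) := by
      intro x hx
      by_cases hxu : x = u
      · rw [hxu]; exact mem_insert_self _ _
      · exact mem_insert_of_mem (mem_erase.2 ⟨hxu, hx⟩)
    have hc := (card_le_card hsub).trans (card_insert_le _ _)
    have hsub2 : ((nonNbrs G Q u).erase u).powersetCard k ⊆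
        (Q.powersetCard k).filter fun K => u ∉ K ∧ ∀ x ∈ K, ¬ G.Adj u x := by
      intro K hK
      obtain ⟨hK, hKc⟩ := mem_powersetCard.1 hK
      refine mem_filter.2 ⟨mem_powersetCard.2 ⟨fun x hx => ?_, hKc⟩, fun hu => ?_, fun x hx => ?_⟩
      · exact (mem_nonNbrs.1 (mem_of_mem_erase (hK hx))).1
      · exact (mem_erase.1 (hK hu)).1 rfl
      · exact (mem_nonNbrs.1 (mem_of_mem_erase (hK hx))).2
    calc (#(nonNbrs G Q u) - k) ^ k ≤ (#((nonNbrs G Q u).erase u) + 1 - k) ^ k := by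
          gcongr
      _ ≤ (#((nonNbrs G Q u).erase u)).descFactorial k := Nat.pow_sub_le_descFactorial _ _
      _ = k.factorial * #(((nonNbrs G Q u).erase u).powersetCard k) := by
          rw [card_powersetCard, Nat.descFactorial_eq_factorial_mul_choose]
      _ ≤ _ := by gcongr
  calc ∑ u, (#(nonNbrs G Q u) - k) ^ k
      ≤ ∑ u : V, k.factorial *
          #((Q.powersetCard k).filter fun K => u ∉ K ∧ ∀ x ∈ K, ¬ G.Adj u x) :=
        sum_le_sum fun u _ => h1 u
    _ = k.factorial * ∑ K ∈ Q.powersetCard k,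
          #(univ.filter fun u => u ∉ K ∧ ∀ x ∈ K, ¬ G.Adj u x) := by
        rw [← mul_sum]
        congr 1
        simp only [card_filter]
        exact sum_comm
    _ ≤ k.factorial * ∑ K ∈ Q.powersetCard k, n := by
        gcongr with K hK
        obtain ⟨hKQ, hKc⟩ := mem_powersetCard.1 hK
        have := h K hKc (hQ.mono hKQ)
        omega
    _ = (#Q).descFactorial k * n := by
        rw [sum_const, card_powersetCard, Nat.descFactorial_eq_factorial_mul_choose, smul_eq_mul,
          mul_assoc]
    _ ≤ _ := by gcongr; exact Nat.descFactorial_le_pow _ _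

/-- If `Y` misses few of the edges to a stable set `Q`, then few vertices outside `Y` have many
nonneighbours in `Q`. -/
theorem NoBook.card_add_card_le (h : NoBook G k n) {Q Y Z : Finset V} {T s E L : ℕ}
    (hQ : Stable G Q) (hT : #Q = T) (hTpos : 0 < T) (hE : 0 < E) (hL : 0 < L)
    (hTE : E * (k * (s + k)) ≤ T) (hTL : 2 * L * k ≤ T) (hsk : s + k ≤ T) (hYZ : Disjoint Y Z)
    (hY : ∀ u ∈ Y, T ≤ #(nonNbrs G Q u) + s) (hZ : ∀ u ∈ Z, T ≤ #(nonNbrs G Q u) * L) :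
    (#Y : ℝ) * (1 - 1 / E) + #Z / (2 * L) ^ k ≤ n := by
  have hT0 : (0 : ℝ) < T := by exact_mod_cast hTpos
  have hE0 : (0 : ℝ) < E := by exact_mod_cast hE
  have hL0 : (0 : ℝ) < L := by exact_mod_cast hL
  have hsum : (∑ u, ((#(nonNbrs G Q u) - k : ℕ) : ℝ) ^ k) ≤ (T : ℝ) ^ k * n := by
    have := h.sum_nonNbrs_pow_le hQ
    rw [hT] at this
    exact_mod_cast this
  -- A vertex of Y has at most s neighbours in Q, so it misses nearly all of Q; by Bernoulli's
  -- inequality its term in the sum is nearly T ^ k.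
  have hYb : ∀ u ∈ Y, (T : ℝ) ^ k * (1 - 1 / E) ≤ ((#(nonNbrs G Q u) - k : ℕ) : ℝ) ^ k := by
    intro u hu
    have h1 : T - (s + k) ≤ #(nonNbrs G Q u) - k := by have := hY u hu; omega
    have h2 : (T : ℝ) - (s + k) ≤ ((#(nonNbrs G Q u) - k : ℕ) : ℝ) := by
      have : ((T - (s + k) : ℕ) : ℝ) ≤ _ := Nat.cast_le.2 h1
      rw [Nat.cast_sub hsk] at this
      push_cast at this ⊢
      exact this
    have hx : ((s : ℝ) + k) / T ≤ 1 := by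
      rw [div_le_one hT0]; exact_mod_cast hsk
    have hbern := one_add_mul_le_pow (a := -(((s : ℝ) + k) / T)) (by linarith) k
    have hkx : (k : ℝ) * (((s : ℝ) + k) / T) ≤ 1 / E := by
      rw [mul_div_assoc', div_le_div_iff₀ hT0 hE0]
      have : ((E * (k * (s + k)) : ℕ) : ℝ) ≤ T := Nat.cast_le.2 hTE
      push_cast at this
      linarith
    calc (T : ℝ) ^ k * (1 - 1 / E) ≤ T ^ k * (1 + -(((s : ℝ) + k) / T)) ^ k := by
          gcongr; linarith
      _ = (T - (s + k)) ^ k := by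
          rw [← mul_pow]; congr 1; field_simp; ring
      _ ≤ _ := by
          apply pow_le_pow_left₀ _ h2
          have : ((s + k : ℕ) : ℝ) ≤ T := Nat.cast_le.2 hsk
          push_cast at this
          linarith
  have hZb : ∀ u ∈ Z, (T : ℝ) ^ k / (2 * L) ^ k ≤ ((#(nonNbrs G Q u) - k : ℕ) : ℝ) ^ k := by
    intro u hu
    rw [← div_pow]
    apply pow_le_pow_left₀ (by positivity)
    have h1 : (T : ℝ) ≤ #(nonNbrs G Q u) * L := by exact_mod_cast hZ u hu
    have h2 : (2 : ℝ) * L * k ≤ T := by exact_mod_cast hTL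
    have h3 : (#(nonNbrs G Q u) : ℝ) ≤ ((#(nonNbrs G Q u) - k : ℕ) : ℝ) + k := by
      exact_mod_cast (by omega : #(nonNbrs G Q u) ≤ #(nonNbrs G Q u) - k + k)
    rw [div_le_iff₀ (by positivity)]
    nlinarith
  have hle : (#Y : ℝ) * (T ^ k * (1 - 1 / E)) + #Z * (T ^ k / (2 * L) ^ k) ≤ T ^ k * n := by
    refine le_trans ?_ hsum
    calc (#Y : ℝ) * (T ^ k * (1 - 1 / E)) + #Z * (T ^ k / (2 * L) ^ k)
        ≤ ∑ u ∈ Y, ((#(nonNbrs G Q u) - k : ℕ) : ℝ) ^ k +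
          ∑ u ∈ Z, ((#(nonNbrs G Q u) - k : ℕ) : ℝ) ^ k := by
          rw [← nsmul_eq_mul, ← nsmul_eq_mul]
          exact add_le_add (card_nsmul_le_sum _ _ _ hYb) (card_nsmul_le_sum _ _ _ hZb)
      _ = ∑ u ∈ Y ∪ Z, ((#(nonNbrs G Q u) - k : ℕ) : ℝ) ^ k := (sum_union hYZ).symm
      _ ≤ _ := sum_le_sum_of_subset_of_nonneg (subset_univ _) fun _ _ _ => by positivity
  have hTk : (0 : ℝ) < (T : ℝ) ^ k := by positivity
  refine le_of_mul_le_mul_left ?_ hTk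
  calc _ = (#Y : ℝ) * (T ^ k * (1 - 1 / E)) + #Z * (T ^ k / (2 * L) ^ k) := by ring
    _ ≤ _ := hle

/-- There are `q` large stable sets that are pairwise joined. -/
theorem exists_joined_stable_family (hB : NoBook G k n) (hJ : NoJoined G q t b) (hb : 0 < b)
    (hk : 1 ≤ k) {s : ℕ} (hks : k ≤ s) (hN : q * n ≤ Fintype.card V + q)
    (hqn : 4 * q ≤ n)
    (hn : 4 * 2 ^ (q * (s * (8 * q * k) ^ q)) * ((s * (8 * q * k) ^ q + 1) ^ (q * t) * b) ≤ n) :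
    ∃ Q : ℕ → Finset V, (∀ i < q, #(Q i) = s ∧ Stable G (Q i)) ∧
      ∀ i j, i < j → j < q → Joined G (Q i) (Q j) := by
  -- Each of the q rounds divides the sizes of the stable sets by C. This factor allows
  -- `card_add_card_le` with E = 4q, since 4q * k * (s1 + k) ≤ 8qk * s1.
  set C := 8 * q * k with hC
  have key : ∀ r ≤ q, ∃ Q : ℕ → Finset V, (∀ i < r, #(Q i) = s * C ^ (q - r) ∧ Stable G (Q i)) ∧
      ∀ i j, i < j → j < r → Joined G (Q i) (Q j) := by
    intro r
    induction r with
    | zero => exact fun _ => ⟨fun _ => ∅, by simp, by simp⟩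
    | succ r ih =>
      intro hr
      obtain ⟨Q, h1, h2⟩ := ih (by omega)
      have hC1 : 1 ≤ C := by
        have : 1 ≤ q * k := Nat.mul_pos (by omega) hk
        rw [hC, mul_assoc]; omega
      set s1 := s * C ^ (q - (r + 1)) with hs1
      have hT1 : s * C ^ (q - r) = C * s1 := by
        rw [hs1, show q - r = q - (r + 1) + 1 by omega]; ring
      rw [hT1] at h1
      have hss1 : s ≤ s1 := Nat.le_mul_of_pos_right _ (by positivity)
      have hTm : C * s1 ≤ s * C ^ q := by
        rw [← hT1]; gcongr; omega
      have hs1m : s1 ≤ s * C ^ q := le_trans (Nat.le_mul_of_pos_left _ hC1) hTm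
      set bad : ℕ → Finset V := fun i => univ.filter fun u => C * s1 ≤ #(nonNbrs G (Q i) u) + s1
        with hbad
      have hq0 : (0 : ℝ) < q := by exact_mod_cast (by omega : 0 < q)
      have hbadc : ∀ i < r, (#(bad i) : ℝ) ≤ n + n / (2 * q) := by
        intro i hi
        have := hB.card_add_card_le (Q := Q i) (Y := bad i) (Z := ∅) (T := C * s1) (s := s1)
          (E := 4 * q) (L := 1) (h1 i hi).2 (h1 i hi).1 (by apply Nat.mul_pos <;> omega)
          (by omega) one_pos
          (by rw [hC]; calc 4 * q * (k * (s1 + k)) ≤ 4 * q * (k * (s1 + s1)) := by gcongr; omega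
                _ = _ := by ring)
          (by calc 2 * 1 * k ≤ 2 * s1 := by omega
                _ ≤ C * s1 := by
                  gcongr
                  have : 1 ≤ q * k := Nat.mul_pos (by omega) hk
                  rw [hC, mul_assoc]; omega)
          (by calc s1 + k ≤ 2 * s1 := by omega
                _ ≤ C * s1 := by
                  gcongr
                  have : 1 ≤ q * k := Nat.mul_pos (by omega) hk
                  rw [hC, mul_assoc]; omega)
          (disjoint_empty_right _) (fun u hu => (mem_filter.1 hu).2)
          (fun u hu => absurd hu (notMem_empty _))
        simp only [card_empty, Nat.cast_zero, zero_div, add_zero] at this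
        push_cast at this
        have hq1 : (1 : ℝ) ≤ q := by exact_mod_cast (by omega : 1 ≤ q)
        have h5 : (1 : ℝ) ≤ (1 - 1 / (4 * q)) * (1 + 1 / (2 * q)) := by
          have : (1 - 1 / (4 * q)) * (1 + 1 / (2 * q)) = 1 + (2 * q - 1) / (8 * (q : ℝ) ^ 2) := by
            field_simp; ring
          rw [this]
          have : (0 : ℝ) ≤ (2 * q - 1) / (8 * (q : ℝ) ^ 2) := by
            apply div_nonneg <;> [linarith; positivity]
          linarith
        calc (#(bad i) : ℝ) ≤ #(bad i) * ((1 - 1 / (4 * q)) * (1 + 1 / (2 * q))) :=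
              le_mul_of_one_le_right (by positivity) h5
          _ = (#(bad i) * (1 - 1 / (4 * q))) * (1 + 1 / (2 * q)) := by ring
          _ ≤ n * (1 + 1 / (2 * q)) := by gcongr
          _ = _ := by ring
      set U : Finset V := univ \ (range r).biUnion bad with hU
      -- There are at most q - 1 sets `bad i`, each of at most n + n / (2q) vertices, so n / 2 - q ≥
      -- n / 4 vertices survive.
      have hUc : n ≤ 4 * #U := by
        have h5 : Fintype.card V ≤ #U + #((range r).biUnion bad) := by
          have := card_sdiff_add_card_eq_card (subset_univ ((range r).biUnion bad))
          rw [card_univ] at this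
          exact this.ge
        have h6 : (#((range r).biUnion bad) : ℝ) ≤ r * (n + n / (2 * q)) := by
          calc (#((range r).biUnion bad) : ℝ) ≤ ∑ i ∈ range r, (#(bad i) : ℝ) := by
                exact_mod_cast card_biUnion_le
            _ ≤ ∑ i ∈ range r, ((n : ℝ) + n / (2 * q)) :=
                sum_le_sum fun i hi => hbadc i (mem_range.1 hi)
            _ = _ := by rw [sum_const, card_range, nsmul_eq_mul]
        have h7 : (q : ℝ) * n ≤ Fintype.card V + q := by exact_mod_cast hN
        have h8 : (4 : ℝ) * q ≤ n := by exact_mod_cast hqn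
        have h9 : (Fintype.card V : ℝ) ≤ #U + #((range r).biUnion bad) := by exact_mod_cast h5
        have hr' : (r : ℝ) ≤ q - 1 := by
          have : ((r + 1 : ℕ) : ℝ) ≤ q := Nat.cast_le.2 hr
          push_cast at this; linarith
        have hn0 : (0 : ℝ) ≤ n := by positivity
        have h10 : (r : ℝ) * (n + n / (2 * q)) ≤ (q - 1) * n + n / 2 := by
          have : (q : ℝ) * (n / (2 * q)) = n / 2 := by field_simp
          have h11 : (0 : ℝ) ≤ n / (2 * q) := by positivity
          nlinarith
        have : (n : ℝ) ≤ 4 * #U := by linarith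
        exact_mod_cast this
      have hUne : U.Nonempty := by
        rw [← card_pos]; omega
      have hPc : #((range r).biUnion Q) ≤ q * (s * C ^ q) := by
        have := card_biUnion_le_card_mul (range r) Q (C * s1) fun i hi =>
          (h1 i (mem_range.1 hi)).1.le
        rw [card_range] at this
        exact this.trans (Nat.mul_le_mul (by omega) hTm)
      -- The new stable set is found among vertices with one common neighbourhood in the old sets.
      -- The old sets are then cut down to that neighbourhood, which makes them joined to the new
      -- one.
      obtain ⟨U', hU'U, ⟨u, hu⟩, hle, hsame⟩ := exists_same_nbrs (G := G) _ U hUne hPc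
      have hU'c : (s1 + 1) ^ (q * t) * b ≤ #U' := by
        have h5 : (s * C ^ q + 1) ^ (q * t) * b ≤ #U' := by
          have : 2 ^ (q * (s * C ^ q)) * (4 * ((s * C ^ q + 1) ^ (q * t) * b)) ≤
              2 ^ (q * (s * C ^ q)) * (4 * #U') := by
            calc _ = 4 * 2 ^ (q * (s * C ^ q)) * ((s * C ^ q + 1) ^ (q * t) * b) := by ring
              _ ≤ n := hn
              _ ≤ 4 * #U := hUc
              _ ≤ 4 * (2 ^ (q * (s * C ^ q)) * #U') := by gcongr
              _ = _ := by ring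
          have := Nat.le_of_mul_le_mul_left this (by positivity)
          omega
        refine le_trans ?_ h5
        gcongr
      obtain ⟨K, hKU, hKc, hKs⟩ := hJ.exists_stable hb hU'c
      have hS : ∀ i, ∃ S, i < r → S ⊆ nbrs G (Q i) u ∧ #S = s1 := by
        intro i
        by_cases hi : i < r
        · have h5 : u ∉ bad i := fun hcon =>
            (mem_sdiff.1 (hU'U hu)).2 (mem_biUnion.2 ⟨i, mem_range.2 hi, hcon⟩)
          have h6 : ¬ C * s1 ≤ #(nonNbrs G (Q i) u) + s1 := fun hcon =>
            h5 (mem_filter.2 ⟨mem_univ _, hcon⟩)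
          have h7 := card_nbrs_add_card_nonNbrs (G := G) (Q i) u
          rw [(h1 i hi).1] at h7
          obtain ⟨S, hS, hSc⟩ := exists_subset_card_eq (s := nbrs G (Q i) u) (n := s1) (by omega)
          exact ⟨S, fun _ => ⟨hS, hSc⟩⟩
        · exact ⟨∅, fun h => absurd h hi⟩
      choose S hS using hS
      have hSQ : ∀ i < r, S i ⊆ Q i := fun i hi => (hS i hi).1.trans nbrs_subset
      refine ⟨fun i => if i < r then S i else K, fun i hi => ?_, fun i j hij hj => ?_⟩
      · dsimp only
        split_ifs with h
        · exact ⟨(hS i h).2, (h1 i h).2.mono (hSQ i h)⟩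
        · exact ⟨hKc, hKs⟩
      · dsimp only
        rw [if_pos (by omega)]
        split_ifs with h
        · exact (h2 i j hij h).mono (hSQ i (by omega)) (hSQ j h)
        · have hi : i < r := by omega
          intro x hx y hy
          obtain ⟨hxQ, hxu⟩ := mem_nbrs.1 ((hS i hi).1 hx)
          have h5 : x ∈ nbrs G ((range r).biUnion Q) u :=
            mem_nbrs.2 ⟨mem_biUnion.2 ⟨i, mem_range.2 hi, hxQ⟩, hxu⟩
          rw [hsame u hu y (hKU hy)] at h5
          exact (mem_nbrs.1 h5).2.symm
  obtain ⟨Q, h1, h2⟩ := key q le_rfl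
  exact ⟨Q, by simpa using h1, h2⟩

end Forbidden

/-! ### Clusters, and large sets with almost all edges between them -/

section Structure

variable {V : Type*}

/-- Remove sets K greedily until fewer than m vertices remain. The bound is proportional to the size
of K, so it adds up over the disjoint sets removed. -/
theorem exists_cover {G : SimpleGraph V} {Z : Finset V} {m : ℕ} {c : ℝ} (Y : Finset V)
    (h : ∀ U ⊆ Y, m ≤ #U → ∃ K ⊆ U, K.Nonempty ∧ ∑ u ∈ Z, (#(nonNbrs G K u) : ℝ) ≤ c * #K) :
    ∃ A ⊆ Y, #(Y \ A) < m ∧ ∑ u ∈ Z, (#(nonNbrs G A u) : ℝ) ≤ c * #A := by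
  induction Y using Finset.strongInduction with
  | H Y ih =>
    rcases lt_or_ge #Y m with hlt | hge
    · exact ⟨∅, empty_subset _, by simpa using hlt, by simp [nonNbrs]⟩
    · obtain ⟨K, hKY, hne, hK⟩ := h Y Subset.rfl hge
      obtain ⟨A, hA, hAc, hAs⟩ := ih (Y \ K) (sdiff_ssubset hKY hne)
        (fun U hU => h U (hU.trans sdiff_subset))
      have hdisj : Disjoint K A := disjoint_sdiff.mono_right hA
      refine ⟨K ∪ A, union_subset hKY (hA.trans sdiff_subset), ?_, ?_⟩
      · rwa [sdiff_sdiff_left, sup_eq_union] at hAc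
      · rw [card_union_of_disjoint hdisj]
        calc ∑ u ∈ Z, (#(nonNbrs G (K ∪ A) u) : ℝ)
            ≤ ∑ u ∈ Z, ((#(nonNbrs G K u) : ℝ) + #(nonNbrs G A u)) := by
              refine sum_le_sum fun u _ => ?_
              rw [nonNbrs, filter_union]
              exact_mod_cast card_union_le _ _
          _ ≤ c * #K + c * #A := by rw [sum_add_distrib]; exact add_le_add hK hAs
          _ = _ := by push_cast; ring

/-- Numerical conditions on the parameters of the argument. -/
structure Params (q k t b n N M L E T : ℕ) : Prop where
  one_le_q : 1 ≤ q
  one_le_k : 1 ≤ k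
  one_le_t : 1 ≤ t
  b_pos : 0 < b
  one_le_M : 1 ≤ M
  L_ge : 16 * q * M * (2 * q + 3) ≤ L
  L_ge' : 2 * (t + 1) ≤ L
  E_ge : 8 * q ^ 2 * ((2 * L) ^ k) ^ 2 * L ≤ E
  T_eq : T = E * (k * (t + k))
  n_ge : E * q ≤ n
  N_ge : q * n ≤ N + q
  N_le : N ≤ 2 * (q + 1) * n
  n_ge_mul_b : 4 * 2 ^ (q * (T * (8 * q * k) ^ q)) *
    ((T * (8 * q * k) ^ q + 1) ^ (q * t) * b) ≤ n
  n_ge_mul_b' : E * (2 ^ (q * T) * b) ≤ n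

namespace Params

variable {q k t b n N M L E T : ℕ}

theorem L_pos (P : Params q k t b n N M L E T) : 0 < L := by have := P.L_ge'; omega

theorem E_ge_L (P : Params q k t b n N M L E T) : 8 * L ≤ E := by
  refine le_trans ?_ P.E_ge
  have h1 : 1 ≤ q ^ 2 := Nat.one_le_pow _ _ P.one_le_q
  have h2 : 1 ≤ ((2 * L) ^ k) ^ 2 :=
    Nat.one_le_pow _ _ (Nat.pow_pos (by have := P.L_pos; omega))
  calc 8 * L = 8 * 1 * 1 * L := by ring
    _ ≤ _ := by gcongr

theorem E_pos (P : Params q k t b n N M L E T) : 0 < E := by have := P.E_ge_L; have := P.L_pos; omega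

theorem mul_k_le_T (P : Params q k t b n N M L E T) : 2 * L * k ≤ T := by
  rw [P.T_eq]
  calc 2 * L * k ≤ E * (k * 1) := by rw [mul_one]; gcongr; have := P.E_ge_L; omega
    _ ≤ _ := by gcongr; have := P.one_le_k; omega

theorem add_le_T (P : Params q k t b n N M L E T) : t + k ≤ T := by
  rw [P.T_eq]
  calc t + k = 1 * (1 * (t + k)) := by ring
    _ ≤ _ := by gcongr; exacts [P.E_pos, P.one_le_k]

theorem two_mul_t_le_T (P : Params q k t b n N M L E T) : 2 * t ≤ T := by
  rw [P.T_eq]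
  calc 2 * t = 2 * (1 * t) := by ring
    _ ≤ _ := by
      gcongr
      · have := P.E_ge_L; have := P.L_pos; omega
      · exact P.one_le_k
      · omega

theorem T_pos (P : Params q k t b n N M L E T) : 0 < T := by have := P.two_mul_t_le_T; have := P.one_le_t; omega

end Params

variable [Fintype V] {G : SimpleGraph V} {q k t b n M L E T : ℕ}

theorem Params.n_le_card (P : Params q k t b n (Fintype.card V) M L E T) :
    (q : ℝ) * n - n / E ≤ Fintype.card V := by
  have h1 : (q : ℝ) * n ≤ Fintype.card V + q := by exact_mod_cast P.N_ge
  have h2 : (E : ℝ) * q ≤ n := by exact_mod_cast P.n_ge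
  have hE : (0 : ℝ) < E := by exact_mod_cast P.E_pos
  have : (q : ℝ) ≤ n / E := by rw [le_div_iff₀ hE]; linarith
  linarith

theorem Params.cast_le_div (P : Params q k t b n (Fintype.card V) M L E T) {x : ℕ}
    (hx : x ≤ 2 ^ (q * T) * b) : (x : ℝ) ≤ n / E := by
  have hE : (0 : ℝ) < E := by exact_mod_cast P.E_pos
  rw [le_div_iff₀ hE]
  have : x * E ≤ n := by
    refine le_trans ?_ P.n_ge_mul_b'
    rw [mul_comm]; gcongr
  exact_mod_cast this

/-- If all but few vertices of a set of about `n` vertices miss few of the edges to a stable set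
`Q`, then few other vertices miss many. -/
theorem Params.card_dense_le (P : Params q k t b n (Fintype.card V) M L E T)
    (hB : NoBook G k n) {Q Y Z : Finset V} (hQ : Stable G Q) (hQT : #Q = T)
    (hYZ : Disjoint Y Z) (hY : ∀ u ∈ Y, T < #(nonNbrs G Q u) + t)
    (hZ : ∀ u ∈ Z, T ≤ #(nonNbrs G Q u) * L) :
    (#Y : ℝ) * (1 - 1 / E) + #Z / (2 * L) ^ k ≤ n := by
  refine hB.card_add_card_le (T := T) (s := t) hQ hQT P.T_pos P.E_pos P.L_pos P.T_eq.ge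
    P.mul_k_le_T P.add_le_T hYZ (fun u hu => (hY u hu).le) hZ

/-- The vertices with at least `t` neighbours in each of `Q 0, …, Q (q - 1)`. -/
noncomputable def exceptional (G : SimpleGraph V) (q t : ℕ) (Q : ℕ → Finset V) : Finset V :=
  univ.filter fun u => ∀ j < q, #(nonNbrs G (Q j) u) + t ≤ #(Q j)

/-- The unexceptional vertices that miss few of the edges to each `Q j` with `j ≠ i`. -/
noncomputable def cluster (G : SimpleGraph V) (q t L : ℕ) (Q : ℕ → Finset V) (i : ℕ) : Finset V :=
  univ.filter fun u => u ∉ exceptional G q t Q ∧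
    ∀ j < q, j ≠ i → #(nonNbrs G (Q j) u) * L < #(Q j)

/-- Pairwise joined stable sets of size `T`. -/
structure JoinedStable (G : SimpleGraph V) (q T : ℕ) (Q : ℕ → Finset V) : Prop where
  card_eq : ∀ i < q, #(Q i) = T
  stable : ∀ i < q, Stable G (Q i)
  joined : ∀ i j, i ≠ j → i < q → j < q → Joined G (Q i) (Q j)

variable {Q : ℕ → Finset V}

theorem card_exceptional_le (hJ : NoJoined G q t b) (hQ : JoinedStable G q T Q) :
    #(exceptional G q t Q) ≤ 2 ^ (q * T) * b := by
  refine hJ.card_le (P := Q) (fun i hi => (hQ.card_eq i hi).le) fun u hu => ?_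
  refine ⟨fun i => nbrs G (Q i) u, fun i hi => ⟨Subset.rfl, ?_⟩, fun i j hij hj => ?_⟩
  · have := (mem_filter.1 hu).2 i hi
    have := card_nbrs_add_card_nonNbrs (G := G) (Q i) u
    dsimp only
    omega
  · exact (hQ.joined i j hij.ne (by omega) hj).mono nbrs_subset nbrs_subset

/-- A vertex in two clusters has few nonneighbours in every `Q l`, hence at least t neighbours in
each, which makes it exceptional. -/
theorem disjoint_cluster (P : Params q k t b n (Fintype.card V) M L E T)
    (hQ : JoinedStable G q T Q) {i j : ℕ} (hij : i ≠ j) :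
    Disjoint (cluster G q t L Q i) (cluster G q t L Q j) := by
  rw [disjoint_left]
  intro u hi hj
  obtain ⟨-, hue, hui⟩ := mem_filter.1 hi
  obtain ⟨-, -, huj⟩ := mem_filter.1 hj
  refine hue (mem_filter.2 ⟨mem_univ _, fun l hl => ?_⟩)
  have h1 : #(nonNbrs G (Q l) u) * L < #(Q l) := by
    by_cases h : l = i
    · exact huj l hl (h ▸ hij)
    · exact hui l hl h
  rw [hQ.card_eq l hl] at h1 ⊢
  have h2 := P.two_mul_t_le_T
  have h3 := P.L_ge'
  have : #(nonNbrs G (Q l) u) * 2 ≤ #(nonNbrs G (Q l) u) * L := by gcongr; omega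
  omega

/-- Let Y_j be the vertices with fewer than t neighbours in `Q j`. Each has at most slightly more
than n vertices, and together they cover all but the few exceptional vertices of a graph with about
qn vertices. So every Y_i has nearly n vertices, which exhausts the bound of `card_dense_le` and
leaves little room for further vertices with many nonneighbours in `Q i`. -/
theorem Params.card_dense_le_of_joined (P : Params q k t b n (Fintype.card V) M L E T)
    (hB : NoBook G k n) (hJ : NoJoined G q t b) (hQ : JoinedStable G q T Q) {i : ℕ} (hi : i < q) :
    (#(univ.filter fun u => T ≤ #(nonNbrs G (Q i) u) * L) : ℝ) ≤
      n + 5 * q * (2 * L) ^ k * (n / E) := by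
  set Y : ℕ → Finset V := fun j => univ.filter fun u => T < #(nonNbrs G (Q j) u) + t with hYdef
  set D : Finset V := univ.filter fun u => T ≤ #(nonNbrs G (Q i) u) * L with hD
  have hmain : ∀ j < q, ∀ Z : Finset V, Disjoint (Y j) Z →
      (∀ u ∈ Z, T ≤ #(nonNbrs G (Q j) u) * L) →
      (#(Y j) : ℝ) * (1 - 1 / E) + #Z / (2 * L) ^ k ≤ n := fun j hj Z hYZ hZ =>
    P.card_dense_le hB (hQ.stable j hj) (hQ.card_eq j hj) hYZ (fun u hu => (mem_filter.1 hu).2) hZ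
  have hE : (0 : ℝ) < E := by exact_mod_cast P.E_pos
  have hE2 : (1 : ℝ) / E ≤ 1 / 2 := by
    have : 2 ≤ E := by have := P.E_ge_L; have := P.L_pos; omega
    have : (2 : ℝ) ≤ E := by exact_mod_cast this
    gcongr
  have hL1 : (1 : ℝ) ≤ L := by exact_mod_cast P.L_pos
  have hH : (1 : ℝ) ≤ (2 * L) ^ k := one_le_pow₀ (by linarith)
  have hq : (1 : ℝ) ≤ q := by exact_mod_cast P.one_le_q
  have hn : (0 : ℝ) ≤ n := by positivity
  set H : ℝ := (2 * L) ^ k with hHdef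
  set e : ℝ := 1 / E with he
  have he0 : 0 < e := by positivity
  have hne : (n : ℝ) / E = e * n := by rw [he]; ring
  have hYle : ∀ j < q, (#(Y j) : ℝ) ≤ n + 2 * e * n := by
    intro j hj
    have h1 := hmain j hj ∅ (disjoint_empty_right _) (fun u hu => absurd hu (notMem_empty _))
    simp only [card_empty, Nat.cast_zero, zero_div, add_zero] at h1
    have h2 : 1 ≤ (1 - e) * (1 + 2 * e) := by nlinarith
    calc (#(Y j) : ℝ) ≤ #(Y j) * ((1 - e) * (1 + 2 * e)) :=
          le_mul_of_one_le_right (by positivity) h2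
      _ = (#(Y j) * (1 - e)) * (1 + 2 * e) := by ring
      _ ≤ n * (1 + 2 * e) := by gcongr
      _ = _ := by ring
  have hYge : (n : ℝ) - 2 * q * e * n ≤ #(Y i) := by
    have h1 : (univ : Finset V) ⊆ exceptional G q t Q ∪ (range q).biUnion Y := by
      intro u _
      by_cases hu : ∃ j < q, u ∈ Y j
      · obtain ⟨j, hj, hu⟩ := hu
        exact mem_union_right _ (mem_biUnion.2 ⟨j, mem_range.2 hj, hu⟩)
      · push Not at hu
        refine mem_union_left _ (mem_filter.2 ⟨mem_univ _, fun j hj => ?_⟩)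
        have := hu j hj
        rw [hYdef, mem_filter] at this
        rw [hQ.card_eq j hj]
        by_contra hcon
        exact this ⟨mem_univ _, not_le.1 hcon⟩
    have h2 : (Fintype.card V : ℝ) ≤ #(exceptional G q t Q) + ∑ j ∈ range q, (#(Y j) : ℝ) := by
      have h3 := (card_le_card h1).trans (card_union_le _ _)
      have h4 : #((range q).biUnion Y) ≤ ∑ j ∈ range q, #(Y j) := card_biUnion_le
      rw [card_univ] at h3
      exact_mod_cast h3.trans (Nat.add_le_add_left h4 _)
    have h3 := P.cast_le_div (card_exceptional_le hJ hQ)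
    rw [← add_sum_erase _ _ (mem_range.2 hi)] at h2
    have h4 : ∑ j ∈ (range q).erase i, (#(Y j) : ℝ) ≤ (q - 1) * (n + 2 * e * n) := by
      calc ∑ j ∈ (range q).erase i, (#(Y j) : ℝ)
          ≤ ∑ j ∈ (range q).erase i, ((n : ℝ) + 2 * e * n) :=
            sum_le_sum fun j hj => hYle j (mem_range.1 (mem_of_mem_erase hj))
        _ = _ := by
          rw [sum_const, card_erase_of_mem (mem_range.2 hi), card_range, nsmul_eq_mul,
            Nat.cast_sub P.one_le_q, Nat.cast_one]
    have h5 := P.n_le_card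
    rw [hne] at h3 h5
    nlinarith
  have hZ := hmain i hi (D \ Y i) disjoint_sdiff (fun u hu => (mem_filter.1 (mem_sdiff.1 hu).1).2)
  have hZ2 : (#(D \ Y i) : ℝ) ≤ 3 * q * e * n * H := by
    have h1 : (#(D \ Y i) : ℝ) / H ≤ 3 * q * e * n := by
      have h2 : (n - 2 * q * e * n) * (1 - e) ≤ #(Y i) * (1 - e) :=
        mul_le_mul_of_nonneg_right hYge (by linarith)
      have h3 : 0 ≤ q * e * n * e := by positivity
      have h4 : e * n ≤ q * (e * n) := le_mul_of_one_le_left (by positivity) hq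
      nlinarith
    rwa [div_le_iff₀ (by linarith)] at h1
  have hDle : (#D : ℝ) ≤ #(Y i) + #(D \ Y i) := by
    have h1 : D ⊆ Y i ∪ (D \ Y i) := by
      intro u hu
      by_cases h : u ∈ Y i
      · exact mem_union_left _ h
      · exact mem_union_right _ (mem_sdiff.2 ⟨hu, h⟩)
    exact_mod_cast (card_le_card h1).trans (card_union_le _ _)
  have h1 := hYle i hi
  rw [hne]
  have h2 : e * n ≤ q * H * (e * n) :=
    le_mul_of_one_le_left (by positivity) (by nlinarith)
  nlinarith

/-- Outside cluster i lie only exceptional vertices and, for each of the q - 1 indices j ≠ i, the at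
most slightly more than n vertices with many nonneighbours in `Q j`. -/
theorem Params.card_cluster_ge (P : Params q k t b n (Fintype.card V) M L E T)
    (hB : NoBook G k n) (hJ : NoJoined G q t b) (hQ : JoinedStable G q T Q) {i : ℕ} (hi : i < q) :
    n - 5 * q ^ 2 * (2 * L) ^ k * (n / E) ≤ (#(cluster G q t L Q i) : ℝ) := by
  set D : ℕ → Finset V := fun j => univ.filter fun u => T ≤ #(nonNbrs G (Q j) u) * L with hD
  have h1 : (univ : Finset V) ⊆ cluster G q t L Q i ∪
      (exceptional G q t Q ∪ ((range q).erase i).biUnion D) := by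
    intro u _
    by_cases hu : u ∈ exceptional G q t Q
    · exact mem_union_right _ (mem_union_left _ hu)
    by_cases hu2 : ∃ j ∈ (range q).erase i, u ∈ D j
    · exact mem_union_right _ (mem_union_right _ (mem_biUnion.2 hu2))
    · push Not at hu2
      refine mem_union_left _ (mem_filter.2 ⟨mem_univ _, hu, fun j hj hji => ?_⟩)
      have := hu2 j (mem_erase.2 ⟨hji, mem_range.2 hj⟩)
      rw [hD, mem_filter] at this
      rw [hQ.card_eq j hj]
      by_contra hcon
      exact this ⟨mem_univ _, not_lt.1 hcon⟩
  have h2 : (Fintype.card V : ℝ) ≤ #(cluster G q t L Q i) + (#(exceptional G q t Q) +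
      ∑ j ∈ (range q).erase i, (#(D j) : ℝ)) := by
    have h3 := (card_le_card h1).trans (card_union_le _ _)
    have h4 := card_union_le (exceptional G q t Q) (((range q).erase i).biUnion D)
    have h5 : #(((range q).erase i).biUnion D) ≤ ∑ j ∈ (range q).erase i, #(D j) :=
      card_biUnion_le
    rw [card_univ] at h3
    have h6 := h3.trans (Nat.add_le_add_left (h4.trans (Nat.add_le_add_left h5 _)) _)
    exact_mod_cast h6
  have h3 := P.cast_le_div (card_exceptional_le hJ hQ)
  have h4 : ∑ j ∈ (range q).erase i, (#(D j) : ℝ) ≤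
      (q - 1) * (n + 5 * q * (2 * L) ^ k * (n / E)) := by
    calc ∑ j ∈ (range q).erase i, (#(D j) : ℝ)
        ≤ ∑ j ∈ (range q).erase i, ((n : ℝ) + 5 * q * (2 * L) ^ k * (n / E)) :=
          sum_le_sum fun j hj =>
            P.card_dense_le_of_joined hB hJ hQ (mem_range.1 (mem_of_mem_erase hj))
      _ = _ := by
        rw [sum_const, card_erase_of_mem (mem_range.2 hi), card_range, nsmul_eq_mul,
          Nat.cast_sub P.one_le_q, Nat.cast_one]
  have h5 := P.n_le_card
  have hL1 : (1 : ℝ) ≤ L := by exact_mod_cast P.L_pos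
  have hH : (1 : ℝ) ≤ (2 * L) ^ k := one_le_pow₀ (by linarith)
  have hq : (1 : ℝ) ≤ q := by exact_mod_cast P.one_le_q
  set H : ℝ := (2 * L) ^ k
  set x : ℝ := n / E
  have hx : 0 ≤ x := by positivity
  have h6 : x ≤ q * H * x := le_mul_of_one_le_left hx (by nlinarith)
  nlinarith

/-- Inside a cluster, almost all vertices miss almost all edges to a given stable set. -/
theorem Params.card_cluster_exceptional_le (P : Params q k t b n (Fintype.card V) M L E T)
    (hJ : NoJoined G q t b) (hQ : JoinedStable G q T Q) {i : ℕ} {K : Finset V}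
    (hK : K ⊆ cluster G q t L Q i) (hKT : #K = T) :
    #((cluster G q t L Q i).filter fun u => #(nonNbrs G K u) + t ≤ T) ≤ 2 ^ (q * T) * b := by
  refine hJ.card_le (P := fun j => if j = i then K else Q j) (fun j hj => ?_) fun u hu => ?_
  · split_ifs
    · exact hKT.le
    · exact (hQ.card_eq j hj).le
  obtain ⟨huc, hut⟩ := mem_filter.1 hu
  have h1 := card_nbrs_add_card_nonNbrs (G := G) K u
  obtain ⟨S, hSK, hSt⟩ := exists_subset_card_eq (s := nbrs G K u) (n := t) (by omega)
  have hnon : ∀ v ∈ cluster G q t L Q i, ∀ j < q, j ≠ i → #(nonNbrs G (Q j) v) ≤ T / L := by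
    intro v hv j hj hji
    rw [Nat.le_div_iff_mul_le P.L_pos, ← hQ.card_eq j hj]
    exact ((mem_filter.1 hv).2.2 j hj hji).le
  -- K replaces `Q i`. In each other `Q j`, the common neighbours of u and of the t vertices of S
  -- are kept: at most (t + 1) * (T / L) ≤ T / 2 are lost, so at least t remain.
  refine ⟨fun j => if j = i then S else
    (nbrs G (Q j) u).filter fun y => ∀ x ∈ S, G.Adj x y, fun j hj => ?_, fun j l hjl hl => ?_⟩
  · dsimp only
    split_ifs with hji
    · exact ⟨hSK, hSt.ge⟩
    · refine ⟨filter_subset _ _, ?_⟩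
      have h2 := card_le_card_common_nbrs (G := G) (Q := nbrs G (Q j) u) (S := S) (d := T / L)
        (fun x hx => (card_le_card (nonNbrs_mono nbrs_subset x)).trans
          (hnon x (hK (nbrs_subset (hSK hx))) j hj hji))
      have h3 := card_nbrs_add_card_nonNbrs (G := G) (Q j) u
      have h4 := hnon u huc j hj hji
      rw [hQ.card_eq j hj] at h3
      rw [hSt] at h2
      have h5 : (t + 1) * (T / L) * 2 ≤ T := by
        calc (t + 1) * (T / L) * 2 = 2 * (t + 1) * (T / L) := by ring
          _ ≤ L * (T / L) := by gcongr; exact P.L_ge'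
          _ ≤ T := Nat.mul_div_le _ _
      have h6 : (t + 1) * (T / L) = t * (T / L) + T / L := by ring
      have h7 := P.two_mul_t_le_T
      have h8 : #(nbrs G (Q j) u) ≤
          #((nbrs G (Q j) u).filter fun y => ∀ x ∈ S, G.Adj x y) + t * (T / L) := by convert h2
      omega
  · dsimp only
    split_ifs with hji hli hli
    · omega
    · exact fun x hx y hy => (mem_filter.1 hy).2 x hx
    · exact fun x hx y hy => ((mem_filter.1 hx).2 y hy).symm
    · exact (hQ.joined j l hjl.ne (by omega) hl).mono
        ((filter_subset _ _).trans nbrs_subset) ((filter_subset _ _).trans nbrs_subset)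

/-- Few vertices outside a cluster miss many of the edges to a given stable set in it. -/
theorem Params.card_dense_sdiff_cluster_le (P : Params q k t b n (Fintype.card V) M L E T)
    (hB : NoBook G k n) (hJ : NoJoined G q t b) (hQ : JoinedStable G q T Q) {i : ℕ} (hi : i < q)
    {K : Finset V} (hK : K ⊆ cluster G q t L Q i) (hKT : #K = T) (hKs : Stable G K) :
    (#(((cluster G q t L Q i)ᶜ).filter fun u => T ≤ #(nonNbrs G K u) * L) : ℝ) ≤ n / L := by
  set Y := (cluster G q t L Q i).filter fun u => T < #(nonNbrs G K u) + t with hY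
  set Z := ((cluster G q t L Q i)ᶜ).filter fun u => T ≤ #(nonNbrs G K u) * L with hZ
  have hYZ : Disjoint Y Z := by
    rw [disjoint_left]
    intro u hu hu'
    exact mem_compl.1 (mem_filter.1 hu').1 (mem_filter.1 hu).1
  -- Nearly the whole cluster, hence about n vertices, lies in Y; this uses up almost all of the
  -- bound n and forces Z to be small.
  have h1 := P.card_dense_le hB hKs hKT hYZ (fun u hu => (mem_filter.1 hu).2)
    (fun u hu => (mem_filter.1 hu).2)
  have h2 : (#(cluster G q t L Q i) : ℝ) ≤ #Y + n / E := by
    have h3 : #((cluster G q t L Q i).filter fun u => #(nonNbrs G K u) + t ≤ T) + #Y =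
        #(cluster G q t L Q i) := by
      rw [← card_filter_add_card_filter_not (s := cluster G q t L Q i)
        (fun u => #(nonNbrs G K u) + t ≤ T)]
      simp only [hY, not_le]
    have h4 := P.cast_le_div (P.card_cluster_exceptional_le hJ hQ hK hKT)
    have h5 : (#((cluster G q t L Q i).filter fun u => #(nonNbrs G K u) + t ≤ T) : ℝ) + #Y =
        #(cluster G q t L Q i) := by exact_mod_cast h3
    linarith
  have h3 := P.card_cluster_ge hB hJ hQ hi
  have hE : (0 : ℝ) < E := by exact_mod_cast P.E_pos
  have hE1 : (1 : ℝ) / E ≤ 1 := by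
    have : (1 : ℝ) ≤ E := by exact_mod_cast P.E_pos
    rw [div_le_one hE]; exact this
  have hL1 : (1 : ℝ) ≤ L := by exact_mod_cast P.L_pos
  have hL0 : (0 : ℝ) < L := by linarith
  have hH : (1 : ℝ) ≤ (2 * L) ^ k := one_le_pow₀ (by linarith)
  have hq : (1 : ℝ) ≤ q := by exact_mod_cast P.one_le_q
  have hEge : 8 * (q : ℝ) ^ 2 * ((2 * L) ^ k) ^ 2 * L ≤ E := by exact_mod_cast P.E_ge
  set H : ℝ := (2 * L) ^ k
  have hne : (n : ℝ) / E = 1 / E * n := by ring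
  rw [hne] at h2 h3
  set e : ℝ := 1 / E with he
  have he0 : 0 < e := by positivity
  have hen : 0 ≤ e * n := by positivity
  have hqH : 1 ≤ q ^ 2 * H := by nlinarith [one_le_pow₀ hq (n := 2)]
  have h4 : e * n ≤ q ^ 2 * H * (e * n) := le_mul_of_one_le_left hen hqH
  have hYge : n - 6 * (q ^ 2 * H * (e * n)) ≤ #Y := by nlinarith
  have h5 : (n - 6 * (q ^ 2 * H * (e * n))) * (1 - e) ≤ #Y * (1 - e) :=
    mul_le_mul_of_nonneg_right hYge (by linarith)
  have h6 : 0 ≤ q ^ 2 * H * (e * n) * e := by positivity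
  have h7 : (#Z : ℝ) / H ≤ 8 * (q ^ 2 * H * (e * n)) := by nlinarith
  rw [div_le_iff₀ (by linarith)] at h7
  refine h7.trans ?_
  rw [le_div_iff₀ hL0]
  calc 8 * (q ^ 2 * H * (e * n)) * H * L = (8 * q ^ 2 * H ^ 2 * L) * e * n := by ring
    _ ≤ E * e * n := by gcongr
    _ = n := by rw [he]; field_simp

/-- There are `q` large sets such that almost all edges between any two of them are present. -/
theorem Params.exists_almost_joined_family (P : Params q k t b n (Fintype.card V) M L E T)
    (hB : NoBook G k n) (hJ : NoJoined G q t b) (hQ : JoinedStable G q T Q) :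
    ∃ W : ℕ → Finset V, (∀ i < q, n ≤ 8 * #(W i)) ∧ ∀ i j, i ≠ j → i < q → j < q →
      ∀ x ∈ W i, M * #(nonNbrs G (W j) x) ≤ #(W j) := by
  have hL1 : (1 : ℝ) ≤ L := by exact_mod_cast P.L_pos
  have hL0 : (0 : ℝ) < L := by linarith
  have hq : (1 : ℝ) ≤ q := by exact_mod_cast P.one_le_q
  have hM : (1 : ℝ) ≤ M := by exact_mod_cast P.one_le_M
  have hn0 : (0 : ℝ) ≤ n := by positivity
  have hTm : T ≤ T * (8 * q * k) ^ q :=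
    Nat.le_mul_of_pos_right _ (Nat.pow_pos (Nat.mul_pos
      (Nat.mul_pos (by omega) P.one_le_q) P.one_le_k))
  set m := (T + 1) ^ (q * t) * b with hm
  have hmn : 4 * m ≤ n := by
    refine le_trans ?_ P.n_ge_mul_b
    calc 4 * m = 4 * 1 * m := by ring
      _ ≤ _ := by
        rw [hm]
        gcongr
        exact Nat.one_le_two_pow
  -- The cluster is covered by disjoint stable T-sets K. Of the at most 2(q + 1)n outside vertices,
  -- each contributes at most T / L, except for at most n / L of them that contribute up to T more;
  -- hence the factor 2q + 3.
  have hcover : ∀ i, ∃ A : Finset V, i < q → A ⊆ cluster G q t L Q i ∧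
      #(cluster G q t L Q i \ A) < m ∧
      ∑ u ∈ (cluster G q t L Q i)ᶜ, (#(nonNbrs G A u) : ℝ) ≤ (2 * q + 3) * n / L * #A := by
    intro i
    by_cases hi : i < q
    swap
    · exact ⟨∅, fun h => absurd h hi⟩
    obtain ⟨A, hA⟩ := exists_cover (G := G) (Z := (cluster G q t L Q i)ᶜ) (m := m)
      (c := (2 * q + 3) * n / L) (cluster G q t L Q i) (fun U hU hmU => by
        obtain ⟨K, hKU, hKT, hKs⟩ := hJ.exists_stable P.b_pos hmU
        refine ⟨K, hKU, card_pos.1 (hKT ▸ P.T_pos), ?_⟩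
        have h1 := P.card_dense_sdiff_cluster_le hB hJ hQ hi (hKU.trans hU) hKT hKs
        set C := (cluster G q t L Q i)ᶜ with hC
        have h2 : ∀ u ∈ C, (#(nonNbrs G K u) : ℝ) ≤
            T / L + if T ≤ #(nonNbrs G K u) * L then (T : ℝ) else 0 := by
          intro u _
          split_ifs with h
          · have : (#(nonNbrs G K u) : ℝ) ≤ T := by
              rw [← hKT]; exact_mod_cast card_le_card nonNbrs_subset
            have : (0 : ℝ) ≤ T / L := by positivity
            linarith
          · rw [add_zero, le_div_iff₀ hL0]
            exact_mod_cast (not_le.1 h).le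
        have h3 : (#C : ℝ) ≤ 2 * (q + 1) * n := by
          have : #C ≤ 2 * (q + 1) * n := (card_le_univ _).trans P.N_le
          exact_mod_cast this
        calc ∑ u ∈ C, (#(nonNbrs G K u) : ℝ) ≤
            ∑ u ∈ C, (T / L + if T ≤ #(nonNbrs G K u) * L then (T : ℝ) else 0) := sum_le_sum h2
          _ = #C * (T / L) + #(C.filter fun u => T ≤ #(nonNbrs G K u) * L) * T := by
            rw [sum_add_distrib, sum_const, nsmul_eq_mul, ← sum_filter, sum_const, nsmul_eq_mul]
          _ ≤ (2 * (q + 1) * n) * (T / L) + n / L * T := by gcongr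
          _ = _ := by rw [hKT]; ring)
    exact ⟨A, fun _ => hA⟩
  choose A hA using hcover
  have hAge : ∀ i < q, n ≤ 2 * #(A i) := by
    intro i hi
    obtain ⟨-, h1, -⟩ := hA i hi
    have h2 := P.card_cluster_ge hB hJ hQ hi
    have hEge : 8 * (q : ℝ) ^ 2 * ((2 * L) ^ k) ^ 2 * L ≤ E := by exact_mod_cast P.E_ge
    have hH : (1 : ℝ) ≤ (2 * L) ^ k := one_le_pow₀ (by linarith)
    have hE : (0 : ℝ) < E := by exact_mod_cast P.E_pos
    have hL4 : (4 : ℝ) ≤ L := by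
      have := P.L_ge'; have := P.one_le_t
      exact_mod_cast (by omega : 4 ≤ L)
    set H : ℝ := (2 * L) ^ k
    have h3 : 5 * (q : ℝ) ^ 2 * H * (n / E) ≤ n / 4 := by
      rw [mul_div_assoc', div_le_div_iff₀ hE (by norm_num)]
      have h4 : 5 * (q : ℝ) ^ 2 * H * 4 ≤ E := by
        refine le_trans ?_ hEge
        have h5 : 8 * (q : ℝ) ^ 2 * H * 4 ≤ 8 * (q : ℝ) ^ 2 * (H ^ 2) * L := by
          gcongr; nlinarith
        have : 0 ≤ (q : ℝ) ^ 2 * H := by positivity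
        linarith
      nlinarith
    have h4 : (#(cluster G q t L Q i) : ℝ) ≤ #(A i) + m := by
      have h5 := card_le_card_sdiff_add_card (t := A i) (s := cluster G q t L Q i)
      exact_mod_cast (by omega : #(cluster G q t L Q i) ≤ #(A i) + m)
    have h5 : (4 : ℝ) * m ≤ n := by exact_mod_cast hmn
    have h6 : (n : ℝ) ≤ 2 * #(A i) := by linarith
    exact_mod_cast h6
  -- By Markov's inequality and the size of L, each `bad i` has at most n / (8q) vertices. Removing
  -- all of them costs n / 8 in total, so `W i` keeps more than half of `A i`, and the factor 2M
  -- here becomes M for the `W i`.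
  set bad : ℕ → Finset V := fun i =>
    ((cluster G q t L Q i)ᶜ).filter fun u => #(A i) < 2 * M * #(nonNbrs G (A i) u) with hbad
  have hbadc : ∀ i < q, (#(bad i) : ℝ) * (8 * q) ≤ n := by
    intro i hi
    obtain ⟨-, -, h1⟩ := hA i hi
    rcases Nat.eq_zero_or_pos #(A i) with h0 | h0
    · have : n = 0 := by have := hAge i hi; omega
      have hb : bad i = ∅ := by
        refine filter_eq_empty_iff.2 fun u _ => ?_
        have : nonNbrs G (A i) u = ∅ := by rw [card_eq_zero.1 h0]; rfl
        simp [this]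
      simp [hb]
    have hA0 : (0 : ℝ) < #(A i) := by exact_mod_cast h0
    have h2 : (#(bad i) : ℝ) * (#(A i) / (2 * M)) ≤
        ∑ u ∈ (cluster G q t L Q i)ᶜ, (#(nonNbrs G (A i) u) : ℝ) := by
      calc (#(bad i) : ℝ) * (#(A i) / (2 * M)) = ∑ u ∈ bad i, ((#(A i) : ℝ) / (2 * M)) := by
            rw [sum_const, nsmul_eq_mul]
        _ ≤ ∑ u ∈ bad i, (#(nonNbrs G (A i) u) : ℝ) := by
          refine sum_le_sum fun u hu => ?_
          rw [div_le_iff₀ (by linarith)]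
          have : (#(A i) : ℝ) < 2 * M * #(nonNbrs G (A i) u) := by
            exact_mod_cast (mem_filter.1 hu).2
          linarith
        _ ≤ _ := sum_le_sum_of_subset_of_nonneg (filter_subset _ _) fun _ _ _ => by positivity
    have h3 : (#(bad i) : ℝ) * L ≤ 2 * M * ((2 * q + 3) * n) := by
      have h4 := h2.trans h1
      rw [mul_div_assoc', div_le_iff₀ (by linarith)] at h4
      have h5 : (#(bad i) : ℝ) * #(A i) ≤ ((2 * q + 3) * n / L * (2 * M)) * #(A i) := by linarith
      have h6 := le_of_mul_le_mul_right h5 hA0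
      calc (#(bad i) : ℝ) * L ≤ ((2 * q + 3) * n / L * (2 * M)) * L := by gcongr
        _ = _ := by field_simp
    have hLge : 16 * (q : ℝ) * M * (2 * q + 3) ≤ L := by exact_mod_cast P.L_ge
    have h4 : (#(bad i) : ℝ) * (16 * (q : ℝ) * M * (2 * q + 3)) ≤ 2 * M * ((2 * q + 3) * n) :=
      le_trans (by gcongr) h3
    have h5 : (0 : ℝ) < 2 * M * (2 * q + 3) := by positivity
    refine le_of_mul_le_mul_left ?_ h5
    linarith
  set W : ℕ → Finset V := fun i => A i \ ((range q).biUnion bad) with hW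
  have hWge : ∀ i < q, 8 * #(A i) ≤ 8 * #(W i) + n := by
    intro i hi
    have h1 := card_le_card_sdiff_add_card (t := (range q).biUnion bad) (s := A i)
    have h2 : (#((range q).biUnion bad) : ℝ) * 8 ≤ n := by
      have h3 : #((range q).biUnion bad) ≤ ∑ i ∈ range q, #(bad i) := card_biUnion_le
      have h4 : (#((range q).biUnion bad) : ℝ) ≤ ∑ i ∈ range q, (#(bad i) : ℝ) := by
        exact_mod_cast h3
      have h5 : ∑ i ∈ range q, (#(bad i) : ℝ) ≤ ∑ i ∈ range q, ((n : ℝ) / (8 * q)) :=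
        sum_le_sum fun i hi => by
          rw [le_div_iff₀ (by positivity)]; exact hbadc i (mem_range.1 hi)
      rw [sum_const, card_range, nsmul_eq_mul] at h5
      have h6 : (q : ℝ) * (n / (8 * q)) = n / 8 := by field_simp
      linarith
    have h3 : #((range q).biUnion bad) * 8 ≤ n := by exact_mod_cast h2
    change 8 * #(A i) ≤ 8 * #(A i \ _) + n
    omega
  refine ⟨W, fun i hi => ?_, fun i j hij hi hj x hx => ?_⟩
  · have := hWge i hi; have := hAge i hi; omega
  · obtain ⟨hxA, hxb⟩ := mem_sdiff.1 hx
    have h1 : x ∉ bad j := fun h => hxb (mem_biUnion.2 ⟨j, mem_range.2 hj, h⟩)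
    have h2 : x ∈ (cluster G q t L Q j)ᶜ := mem_compl.2 fun h =>
      disjoint_left.1 (disjoint_cluster P hQ hij) ((hA i hi).1 hxA) h
    have h3 : 2 * M * #(nonNbrs G (A j) x) ≤ #(A j) := by
      by_contra hcon
      exact h1 (mem_filter.2 ⟨h2, not_le.1 hcon⟩)
    have h4 : #(nonNbrs G (W j) x) ≤ #(nonNbrs G (A j) x) :=
      card_le_card (nonNbrs_mono sdiff_subset x)
    have h5 : M * #(nonNbrs G (W j) x) ≤ M * #(nonNbrs G (A j) x) := Nat.mul_le_mul_left _ h4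
    have := hWge j hj; have := hAge j hj
    rw [mul_assoc] at h3
    omega

end Structure

/-! ### The sharp bound by averaging over stable `k`-sets -/

section Counting

variable {V : Type*}

/-- There are no pairwise joined sets of sizes `a 1, …, a p`. -/
def NoParts (G : SimpleGraph V) (p : ℕ) (a : ℕ → ℕ) : Prop :=
  ∀ S : ℕ → Finset V, (∀ i < p, a (i + 1) ≤ #(S i)) →
    ¬ ∀ i j, i < j → j < p → Joined G (S i) (S j)

theorem NoParts.noJoined {G : SimpleGraph V} {q t : ℕ} {a : ℕ → ℕ} (h : NoParts G (q + 1) a)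
    (ha : ∀ i, 1 ≤ i → i ≤ q → a i ≤ t) : NoJoined G q t (a (q + 1)) := by
  intro S U h1 h2 h3
  by_contra hU
  refine h (fun i => if i < q then S i else U) (fun i hi => ?_) (fun i j hij hj => ?_)
  · split_ifs with h
    · exact (ha (i + 1) (by omega) (by omega)).trans (h1 i h)
    · obtain rfl : i = q := by omega
      exact not_lt.1 hU
  · rw [if_pos (by omega)]
    split_ifs with h
    · exact h2 i j hij h
    · exact h3 i (by omega)

/-- Large sets such that almost all edges between any two of them are present, in a graph
without `K_{q+1}(a 1, …, a (q + 1))`. -/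
structure AlmostJoined (G : SimpleGraph V) (q t k n R : ℕ) (a : ℕ → ℕ) (W : ℕ → Finset V) :
    Prop where
  noParts : NoParts G (q + 1) a
  one_le_q : 1 ≤ q
  one_le_t : 1 ≤ t
  one_le_k : 1 ≤ k
  a_one : a 1 = 1
  one_le_a : 1 ≤ a 2
  a_le : ∀ i, 1 ≤ i → i ≤ q → a i ≤ t
  R_eq : R = 2 * k * (8 * t) ^ k
  n_ge_mul_a : 16 * R * a (q + 1) ≤ n
  n_ge_mul_t : 16 * R * (k * t) ≤ n
  n_le : ∀ i < q, n ≤ 8 * #(W i)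
  card_nonNbrs : ∀ i j, i ≠ j → i < q → j < q → ∀ x ∈ W i,
    4 * (q + 1) * t * R * #(nonNbrs G (W j) x) ≤ #(W j)

/-- The vertices that miss few of the edges to each `W j` with `j ≠ i`. -/
noncomputable def typical [Fintype V] (G : SimpleGraph V) (q t : ℕ) (W : ℕ → Finset V) (i : ℕ) :
    Finset V :=
  univ.filter fun v => ∀ j < q, j ≠ i → 4 * t * #(nonNbrs G (W j) v) ≤ #(W j)

namespace AlmostJoined

variable {G : SimpleGraph V} {q t k n R : ℕ} {a : ℕ → ℕ} {W : ℕ → Finset V}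

theorem R_ge (h : AlmostJoined G q t k n R a W) : 16 * k * t ≤ R := by
  rw [h.R_eq]
  calc 16 * k * t = 2 * k * (8 * t) ^ 1 := by ring
    _ ≤ _ := by
      gcongr
      · have := h.one_le_t; omega
      · exact h.one_le_k

theorem R_ge_t (h : AlmostJoined G q t k n R a W) : 16 * t ≤ R := by
  refine le_trans ?_ h.R_ge
  gcongr
  have := h.one_le_k; omega

theorem R_ge_k (h : AlmostJoined G q t k n R a W) : 16 * k ≤ R :=
  le_trans (Nat.le_mul_of_pos_right _ h.one_le_t) h.R_ge

/-- The last size need not be at most t and has a hypothesis of its own. For q = 1 this is already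
the size `a 2`. -/
theorem n_ge (h : AlmostJoined G q t k n R a W) {i : ℕ} (h1 : 1 ≤ i) (hi : i ≤ q + 1) :
    16 * R * a i ≤ n := by
  rcases Nat.lt_or_ge q i with hq | hq
  · obtain rfl : i = q + 1 := by omega
    exact h.n_ge_mul_a
  · refine le_trans ?_ h.n_ge_mul_t
    gcongr
    exact (h.a_le i h1 hq).trans (Nat.le_mul_of_pos_left _ h.one_le_k)

/-- Otherwise v is the part of size `a 1 = 1`, and the q other parts can be chosen greedily from its
neighbourhoods in the `W i`, where nonedges between different sets are still rare. -/
theorem exists_card_nbrs_lt (h : AlmostJoined G q t k n R a W) (v : V) :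
    ∃ i < q, R * #(nbrs G (W i) v) < #(W i) := by
  by_contra hcon
  push Not at hcon
  have hR : 0 < R := by have := h.R_ge_t; have := h.one_le_t; omega
  obtain ⟨S, hS, hSS⟩ := exists_joined_family_of_few_nonNbrs (G := G) (r := q) (t := t)
    (X := fun j => nbrs G (W j) v) (b := fun j => a (j + 2))
    (fun j hj => h.a_le (j + 2) (by omega) (by omega))
    (fun j hj => by
      have h1 := h.n_ge (i := j + 2) (by omega) (by omega)
      have h2 := h.n_le j hj
      have h3 := hcon j hj
      have h4 : (8 * R) * (2 * a (j + 2)) ≤ (8 * R) * #(nbrs G (W j) v) := by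
        calc _ = 16 * R * a (j + 2) := by ring
          _ ≤ 8 * (R * #(nbrs G (W j) v)) := by omega
          _ = _ := by ring
      exact Nat.le_of_mul_le_mul_left h4 (by omega))
    (fun i j hij hj x hx => by
      have h1 := h.card_nonNbrs i j hij.ne (by omega) hj x (nbrs_subset hx)
      have h2 := hcon j hj
      have h3 : #(nonNbrs G (nbrs G (W j) v) x) ≤ #(nonNbrs G (W j) x) :=
        card_le_card (nonNbrs_mono nbrs_subset x)
      refine Nat.le_of_mul_le_mul_left (c := R) ?_ hR
      calc R * (2 * q * t * #(nonNbrs G (nbrs G (W j) v) x))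
          ≤ R * (4 * (q + 1) * t * #(nonNbrs G (W j) x)) := by gcongr <;> omega
        _ = 4 * (q + 1) * t * R * #(nonNbrs G (W j) x) := by ring
        _ ≤ _ := h1.trans h2)
  refine h.noParts (fun i => if i = 0 then {v} else S (i - 1)) (fun i hi => ?_)
    (fun i j hij hj => ?_)
  · split_ifs with h0
    · subst h0
      simp [h.a_one]
    · rw [(hS (i - 1) (by omega)).2, show i - 1 + 2 = i + 1 by omega]
  · rw [if_neg (show j ≠ 0 by omega)]
    split_ifs with h0
    · intro x hx y hy
      rw [mem_singleton.1 hx]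
      exact (mem_nbrs.1 ((hS (j - 1) (by omega)).1 hy)).2
    · exact hSS _ _ (by omega) (by omega)

theorem mul_a_lt (h : AlmostJoined G q t k n R a W) {i : ℕ} (hi : i < q) :
    k * a 2 < #(W i) := by
  have hq := h.one_le_q
  have h1 := h.n_ge (i := 2) (by omega) (by omega)
  have h2 : 16 * (16 * k) * a 2 ≤ 16 * R * a 2 := by gcongr; exact h.R_ge_k
  have h3 : 1 ≤ k * a 2 := Nat.mul_pos h.one_le_k h.one_le_a
  have h4 := h.n_le i hi
  have h5 : 16 * (16 * k) * a 2 = 256 * (k * a 2) := by ring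
  omega

variable [Fintype V]

/-- Otherwise v and `a 2` of its neighbours in the set form the first two parts. Being typical,
these vertices have common neighbours in at least half of each other `W j`, where the remaining q -
1 parts are found greedily. -/
theorem card_nbrs_typical_lt (h : AlmostJoined G q t k n R a W) {i : ℕ} (hi : i < q) {v : V}
    (hv : v ∈ typical G q t W i) : #(nbrs G (typical G q t W i) v) < a 2 := by
  by_contra hcon
  obtain ⟨F, hF, hFc⟩ := exists_subset_card_eq (not_lt.1 hcon)
  have hFt : ∀ x ∈ insert v F, x ∈ typical G q t W i := fun x hx => by
    rcases mem_insert.1 hx with rfl | hx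
    · exact hv
    · exact nbrs_subset (hF hx)
  -- The values σ 1, …, σ (q - 1) list the indices other than i.
  set σ := Equiv.swap 0 i with hσ
  have hσq : ∀ j, j + 1 < q → σ (j + 1) < q := fun j hj => by
    rw [hσ, Equiv.swap_apply_def]; split_ifs <;> omega
  have hσi : ∀ j, σ (j + 1) ≠ i := fun j hj => by
    have := σ.injective (hj.trans (Equiv.swap_apply_left 0 i).symm)
    omega
  have ht := h.one_le_t
  have hR := h.R_ge_t
  have hX : ∀ j, j + 1 < q → #(W (σ (j + 1))) ≤
      2 * #((W (σ (j + 1))).filter fun y => ∀ x ∈ insert v F, G.Adj x y) := by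
    intro j hj
    have h1 := card_le_card_common_nbrs (G := G) (Q := W (σ (j + 1))) (S := insert v F)
      (d := #(W (σ (j + 1))) / (4 * t)) (fun x hx => by
        rw [Nat.le_div_iff_mul_le (by omega), mul_comm]
        exact (mem_filter.1 (hFt x hx)).2 _ (hσq j hj) (hσi j))
    have h2 : #(insert v F) ≤ 2 * t := by
      have := card_insert_le v F
      have := h.a_le 2 (by omega) (by omega)
      omega
    have h3 : #(insert v F) * (#(W (σ (j + 1))) / (4 * t)) * 2 ≤ #(W (σ (j + 1))) := by
      calc #(insert v F) * (#(W (σ (j + 1))) / (4 * t)) * 2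
          ≤ (2 * t) * (#(W (σ (j + 1))) / (4 * t)) * 2 := by gcongr
        _ = (4 * t) * (#(W (σ (j + 1))) / (4 * t)) := by ring
        _ ≤ _ := Nat.mul_div_le _ _
    have h4 : #(W (σ (j + 1))) ≤
      #((W (σ (j + 1))).filter fun y => ∀ x ∈ insert v F, G.Adj x y) +
        #(insert v F) * (#(W (σ (j + 1))) / (4 * t)) := by convert h1
    omega
  obtain ⟨S, hS, hSS⟩ := exists_joined_family_of_few_nonNbrs (G := G) (r := q - 1) (t := t)
    (X := fun j => (W (σ (j + 1))).filter fun y => ∀ x ∈ insert v F, G.Adj x y)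
    (b := fun j => a (j + 3)) (fun j hj => h.a_le (j + 3) (by omega) (by omega))
    (fun j hj => by
      have h1 := h.n_ge (i := j + 3) (by omega) (by omega)
      have h2 := h.n_le _ (hσq j (by omega))
      have h3 := hX j (by omega)
      have h4 : 16 * 2 * a (j + 3) ≤ 16 * R * a (j + 3) := by gcongr; omega
      omega)
    (fun i' j hij hj x hx => by
      have h1 := h.card_nonNbrs (σ (i' + 1)) (σ (j + 1))
        (fun heq => by have := σ.injective heq; omega) (hσq i' (by omega)) (hσq j (by omega)) x
        (filter_subset _ _ hx)
      have h2 := hX j (by omega)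
      set X := (W (σ (j + 1))).filter fun y => ∀ x ∈ insert v F, G.Adj x y
      have h3 : #(nonNbrs G X x) ≤ #(nonNbrs G (W (σ (j + 1))) x) :=
        card_le_card (nonNbrs_mono (filter_subset _ _) x)
      refine Nat.le_of_mul_le_mul_left (c := 2) ?_ two_pos
      calc 2 * (2 * (q - 1) * t * #(nonNbrs G X x))
          = 4 * (q - 1) * t * 1 * #(nonNbrs G X x) := by ring
        _ ≤ 4 * (q + 1) * t * R * #(nonNbrs G (W (σ (j + 1))) x) := by gcongr <;> omega
        _ ≤ _ := h1.trans h2)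
  refine h.noParts (fun i => if i = 0 then {v} else if i = 1 then F else S (i - 2))
    (fun i hi => ?_) (fun i j hij hj => ?_)
  · split_ifs with h0 h1
    · subst h0
      simp [h.a_one]
    · subst h1
      exact hFc.ge
    · rw [(hS (i - 2) (by omega)).2, show i - 2 + 3 = i + 1 by omega]
  · rw [if_neg (show j ≠ 0 by omega)]
    have hmem : ∀ l, l + 2 < q + 1 → ∀ y ∈ S l, ∀ x ∈ insert v F, G.Adj x y := fun l hl y hy =>
      (mem_filter.1 ((hS l (by omega)).1 hy)).2
    split_ifs with h0 h1 h1 h2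
    · intro x hx y hy
      rw [mem_singleton.1 hx]
      exact (mem_nbrs.1 (hF hy)).2
    · intro x hx y hy
      rw [mem_singleton.1 hx]
      exact hmem _ (by omega) y hy v (mem_insert_self _ _)
    · omega
    · intro x hx y hy
      exact hmem _ (by omega) y hy x (mem_insert_of_mem hx)
    · omega
    · exact hSS _ _ (by omega) (by omega)

theorem subset_typical (h : AlmostJoined G q t k n R a W) {i : ℕ} (hi : i < q) :
    W i ⊆ typical G q t W i := by
  refine fun x hx => mem_filter.2 ⟨mem_univ _, fun j hj hji => ?_⟩
  refine le_trans ?_ (h.card_nonNbrs i j hji.symm hi hj x hx)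
  have := h.R_ge_t
  have := h.one_le_t
  calc 4 * t * #(nonNbrs G (W j) x) = 4 * 1 * t * 1 * #(nonNbrs G (W j) x) := by ring
    _ ≤ _ := by gcongr <;> omega

theorem card_nbrs_lt (h : AlmostJoined G q t k n R a W) {i : ℕ} (hi : i < q) :
    ∀ x ∈ W i, #(nbrs G (W i) x) < a 2 := fun _ hx =>
  (card_le_card (filter_subset_filter _ (h.subset_typical hi))).trans_lt
    (h.card_nbrs_typical_lt hi (h.subset_typical hi hx))

/-- The proportion of stable `k`-subsets of `W i` to which `z` has no edge. -/
theorem pow_le_proportion (h : AlmostJoined G q t k n R a W) {i : ℕ} (hi : i < q) (z : V)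
    {x : ℝ} (hx : 0 ≤ x) (hxW : x * #(W i) + k * a 2 ≤ #(nonNbrs G (W i) z)) :
    x ^ k ≤ (#(stableSets G k (nonNbrs G (W i) z)) : ℝ) / #(stableSets G k (W i)) := by
  have hpos : 0 < #(stableSets G k (W i)) :=
    card_pos.2 (stableSets_nonempty (h.card_nbrs_lt hi) (h.mul_a_lt hi))
  rw [le_div_iff₀ (by exact_mod_cast hpos)]
  have h1 := pow_le_factorial_mul_card_stableSets (G := G) (X := nonNbrs G (W i) z) (d := a 2)
    (fun y hy => (card_le_card (filter_subset_filter _ nonNbrs_subset)).trans_lt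
      (h.card_nbrs_lt hi y (nonNbrs_subset hy))) k
  have h2 := factorial_mul_card_stableSets_le (G := G) k (W i)
  have hf : (0 : ℝ) < k.factorial := by exact_mod_cast k.factorial_pos
  refine le_of_mul_le_mul_left ?_ hf
  have h3 : ((#(nonNbrs G (W i) z) - k * a 2 : ℕ) : ℝ) ^ k ≤
      k.factorial * #(stableSets G k (nonNbrs G (W i) z)) := by exact_mod_cast h1
  have h4 : (k.factorial : ℝ) * #(stableSets G k (W i)) ≤ #(W i) ^ k := by exact_mod_cast h2
  have h5 : x * #(W i) ≤ ((#(nonNbrs G (W i) z) - k * a 2 : ℕ) : ℝ) := by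
    have : (#(nonNbrs G (W i) z) : ℝ) ≤
        ((#(nonNbrs G (W i) z) - k * a 2 : ℕ) : ℝ) + k * a 2 := by
      exact_mod_cast (by omega : #(nonNbrs G (W i) z) ≤ #(nonNbrs G (W i) z) - k * a 2 + k * a 2)
    linarith
  calc (k.factorial : ℝ) * (x ^ k * #(stableSets G k (W i)))
      = x ^ k * (k.factorial * #(stableSets G k (W i))) := by ring
    _ ≤ x ^ k * #(W i) ^ k := by gcongr
    _ = (x * #(W i)) ^ k := (mul_pow _ _ _).symm
    _ ≤ _ := pow_le_pow_left₀ (by positivity) h5 _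
    _ ≤ _ := h3

/-- Some `W i` contains almost no neighbours of z, giving a proportion of at least 1 - 2k / R. As z
is not typical for that i, it has many nonneighbours in another `W j`, and this adds at least (1 /
(8t)) ^ k, which makes up the deficit. -/
theorem one_le_sum_proportion (h : AlmostJoined G q t k n R a W) {z : V}
    (hz : ∀ i < q, z ∉ typical G q t W i) :
    1 ≤ ∑ i ∈ range q,
      (#(stableSets G k (nonNbrs G (W i) z)) : ℝ) / #(stableSets G k (W i)) := by
  obtain ⟨i, hi, hlt⟩ := h.exists_card_nbrs_lt z
  have hzi := hz i hi
  simp only [typical, mem_filter, mem_univ, true_and, not_forall, not_le, exists_prop] at hzi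
  obtain ⟨j, hj, hji, hjlt⟩ := hzi
  have ht : (1 : ℝ) ≤ t := by exact_mod_cast h.one_le_t
  have hk : (1 : ℝ) ≤ k := by exact_mod_cast h.one_le_k
  have hRt : (16 : ℝ) * k * t ≤ R := by exact_mod_cast h.R_ge
  have hkt : (1 : ℝ) ≤ k * t := by nlinarith
  have hR0 : (0 : ℝ) < R := by nlinarith
  -- The distinct indices i and j show that q ≥ 2, so `a 2` is not the last size.
  have ha2 : (a 2 : ℝ) ≤ t := by exact_mod_cast h.a_le 2 (by omega) (by omega)
  have hnR : (16 : ℝ) * R * (k * t) ≤ n := by exact_mod_cast h.n_ge_mul_t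
  have hka : (k : ℝ) * a 2 ≤ k * t := by gcongr
  have hi1 : (1 - 2 / (R : ℝ)) ^ k ≤ _ := h.pow_le_proportion hi z
    (x := 1 - 2 / (R : ℝ)) (by
      have : 2 / (R : ℝ) ≤ 1 := by rw [div_le_one hR0]; nlinarith
      linarith) (by
      have h1 : (R : ℝ) * #(nbrs G (W i) z) < #(W i) := by exact_mod_cast hlt
      have h2 : (#(nbrs G (W i) z) : ℝ) + #(nonNbrs G (W i) z) = #(W i) := by
        exact_mod_cast card_nbrs_add_card_nonNbrs (G := G) (W i) z
      have h3 : (n : ℝ) ≤ 8 * #(W i) := by exact_mod_cast h.n_le i hi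
      have h4 : (#(nbrs G (W i) z) : ℝ) ≤ #(W i) / R := by
        rw [le_div_iff₀ hR0]; linarith
      have h5 : (k : ℝ) * t ≤ #(W i) / R := by
        rw [le_div_iff₀ hR0]; nlinarith
      have h6 : (1 - 2 / (R : ℝ)) * #(W i) = #(W i) - 2 * (#(W i) / R) := by ring
      rw [h6]; linarith)
  have hj1 : (1 / (8 * (t : ℝ))) ^ k ≤ _ := h.pow_le_proportion hj z
    (x := 1 / (8 * (t : ℝ))) (by positivity) (by
      have h1 : (#(W j) : ℝ) < 4 * t * #(nonNbrs G (W j) z) := by exact_mod_cast hjlt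
      have h3 : (n : ℝ) ≤ 8 * #(W j) := by exact_mod_cast h.n_le j hj
      have h4 : (#(W j) : ℝ) / (4 * t) ≤ #(nonNbrs G (W j) z) := by
        rw [div_le_iff₀ (by positivity)]; linarith
      have h5 : (k : ℝ) * t ≤ #(W j) / (8 * t) := by
        rw [le_div_iff₀ (by positivity)]
        have : (8 : ℝ) * t ≤ R := by nlinarith
        have : (k : ℝ) * t * (8 * t) ≤ k * t * R := by gcongr
        nlinarith
      have h6 : (#(W j) : ℝ) / (4 * t) = 2 * (#(W j) / (8 * t)) := by field_simp; ring
      have h7 : 1 / (8 * (t : ℝ)) * #(W j) = #(W j) / (8 * t) := by ring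
      rw [h7]; linarith)
  have hbern := one_add_mul_le_pow (a := -(2 / (R : ℝ))) (by
    have : 2 / (R : ℝ) ≤ 1 := by rw [div_le_one hR0]; nlinarith
    linarith) k
  -- R is chosen so that the loss at i equals the gain at j.
  have hRe : (k : ℝ) * (2 / R) = (1 / (8 * (t : ℝ))) ^ k := by
    have : (R : ℝ) = 2 * k * (8 * t) ^ k := by exact_mod_cast h.R_eq
    rw [this, one_div, inv_pow]
    field_simp
  have hsub : ({i, j} : Finset ℕ) ⊆ range q := by
    intro l hl
    rcases mem_insert.1 hl with rfl | hl
    · exact mem_range.2 hi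
    · rw [mem_singleton.1 hl]; exact mem_range.2 hj
  calc (1 : ℝ) ≤ (1 - 2 / (R : ℝ)) ^ k + (1 / (8 * (t : ℝ))) ^ k := by
        rw [sub_eq_add_neg]; linarith
    _ ≤ _ := add_le_add hi1 hj1
    _ = ∑ l ∈ ({i, j} : Finset ℕ),
      (#(stableSets G k (nonNbrs G (W l) z)) : ℝ) / #(stableSets G k (W l)) :=
        (sum_pair (f := fun l => (#(stableSets G k (nonNbrs G (W l) z)) : ℝ) /
          #(stableSets G k (W l))) hji.symm).symm
    _ ≤ _ := sum_le_sum_of_subset_of_nonneg hsub fun _ _ _ => by positivity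

/-- The left side is the average, over stable k-sets K in `W i`, of the number of vertices of Z with
no edge to K. For each K, at most `k * a 2` typical vertices lie in the closed neighbourhoods of K;
the others are pages of the same book and count against n - k - 1. -/
theorem sum_proportion_le (h : AlmostJoined G q t k n R a W) (hB : NoBook G k n) {i : ℕ}
    (hi : i < q) {Z : Finset V} (hZ : Disjoint Z (typical G q t W i)) :
    ∑ z ∈ Z, (#(stableSets G k (nonNbrs G (W i) z)) : ℝ) / #(stableSets G k (W i)) ≤
      n - k - 1 - #(typical G q t W i) + k * a 2 := by
  have hpos : 0 < #(stableSets G k (W i)) :=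
    card_pos.2 (stableSets_nonempty (h.card_nbrs_lt hi) (h.mul_a_lt hi))
  rw [← sum_div, div_le_iff₀ (by exact_mod_cast hpos)]
  set Y := typical G q t W i with hY
  have hK : ∀ K ∈ stableSets G k (W i),
      (#(Z.filter fun z => ∀ x ∈ K, ¬ G.Adj z x) : ℝ) ≤ n - k - 1 - #Y + k * a 2 := by
    intro K hK
    obtain ⟨hKW, hKk, hKs⟩ := mem_stableSets.1 hK
    have hKY : K ⊆ Y := hKW.trans (h.subset_typical hi)
    have h1 := hB K hKk hKs
    have h2 : Y ⊆ (Y.filter fun u => u ∉ K ∧ ∀ x ∈ K, ¬ G.Adj u x) ∪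
        K.biUnion fun x => insert x (nbrs G Y x) := by
      intro y hy
      by_cases hc : y ∉ K ∧ ∀ x ∈ K, ¬ G.Adj y x
      · exact mem_union_left _ (mem_filter.2 ⟨hy, hc⟩)
      · refine mem_union_right _ (mem_biUnion.2 ?_)
        by_cases hyK : y ∈ K
        · exact ⟨y, hyK, mem_insert_self _ _⟩
        · have : ∃ x ∈ K, G.Adj y x := by
            by_contra hcc
            push Not at hcc
            exact hc ⟨hyK, hcc⟩
          obtain ⟨x, hx, hxy⟩ := this
          exact ⟨x, hx, mem_insert_of_mem (mem_nbrs.2 ⟨hy, hxy.symm⟩)⟩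
    have h3 : #Y ≤ #(Y.filter fun u => u ∉ K ∧ ∀ x ∈ K, ¬ G.Adj u x) + k * a 2 := by
      calc #Y ≤ _ := card_le_card h2
        _ ≤ _ := card_union_le _ _
        _ ≤ _ := by
          rw [← hKk]
          gcongr
          refine card_biUnion_le_card_mul _ _ _ fun x hx => ?_
          exact (card_insert_le _ _).trans (h.card_nbrs_typical_lt hi (hKY hx))
    have h4 : #(Y.filter fun u => u ∉ K ∧ ∀ x ∈ K, ¬ G.Adj u x) +
        #(Z.filter fun z => ∀ x ∈ K, ¬ G.Adj z x) ≤
        #(univ.filter fun u => u ∉ K ∧ ∀ x ∈ K, ¬ G.Adj u x) := by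
      rw [← card_union_of_disjoint
        (disjoint_of_subset_left (filter_subset _ _)
          (disjoint_of_subset_right (filter_subset _ _) hZ.symm))]
      refine card_le_card (union_subset (filter_subset_filter _ (subset_univ _)) fun z hz => ?_)
      obtain ⟨hzZ, hzK⟩ := mem_filter.1 hz
      exact mem_filter.2 ⟨mem_univ _, fun hc => disjoint_left.1 hZ hzZ (hKY hc), hzK⟩
    have h5 : #(Z.filter fun z => ∀ x ∈ K, ¬ G.Adj z x) + k + 1 + #Y ≤ n + k * a 2 := by omega
    have h6 : (#(Z.filter fun z => ∀ x ∈ K, ¬ G.Adj z x) : ℝ) + k + 1 + #Y ≤ n + k * a 2 := by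
      exact_mod_cast h5
    linarith
  have hswap : ∑ z ∈ Z, #(stableSets G k (nonNbrs G (W i) z)) =
      ∑ K ∈ stableSets G k (W i), #(Z.filter fun z => ∀ x ∈ K, ¬ G.Adj z x) := by
    have h1 : ∀ z, stableSets G k (nonNbrs G (W i) z) =
        (stableSets G k (W i)).filter fun K => ∀ x ∈ K, ¬ G.Adj z x := by
      intro z
      ext K
      simp only [mem_stableSets, mem_filter]
      constructor
      · rintro ⟨h1, h2, h3⟩
        exact ⟨⟨h1.trans nonNbrs_subset, h2, h3⟩, fun x hx => (mem_nonNbrs.1 (h1 hx)).2⟩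
      · rintro ⟨⟨h1, h2, h3⟩, h4⟩
        exact ⟨fun x hx => mem_nonNbrs.2 ⟨h1 hx, h4 x hx⟩, h2, h3⟩
    simp only [h1, card_filter]
    exact sum_comm
  calc (∑ z ∈ Z, (#(stableSets G k (nonNbrs G (W i) z)) : ℝ))
      = ∑ K ∈ stableSets G k (W i), (#(Z.filter fun z => ∀ x ∈ K, ¬ G.Adj z x) : ℝ) := by
        exact_mod_cast hswap
    _ ≤ ∑ K ∈ stableSets G k (W i), ((n : ℝ) - k - 1 - #Y + k * a 2) := sum_le_sum hK
    _ = _ := by rw [sum_const, nsmul_eq_mul, mul_comm]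

/-- Every vertex that is typical for no i has total weight at least 1. Summing `sum_proportion_le`
over i, the sizes of the typical sets cancel against those in the union bound for V. -/
theorem card_add_le (h : AlmostJoined G q t k n R a W) (hB : NoBook G k n) :
    Fintype.card V + q * k + q ≤ q * n + q * (k * a 2) := by
  set Z : Finset V := univ \ (range q).biUnion (typical G q t W) with hZ
  have h1 : Fintype.card V ≤ #Z + ∑ i ∈ range q, #(typical G q t W i) := by
    have h2 := card_sdiff_add_card_eq_card (subset_univ ((range q).biUnion (typical G q t W)))
    have h3 : #((range q).biUnion (typical G q t W)) ≤ ∑ i ∈ range q, #(typical G q t W i) :=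
      card_biUnion_le
    rw [card_univ] at h2
    rw [hZ]
    omega
  have hZt : ∀ z ∈ Z, ∀ i < q, z ∉ typical G q t W i := fun z hz i hi hc =>
    (mem_sdiff.1 hz).2 (mem_biUnion.2 ⟨i, mem_range.2 hi, hc⟩)
  have h2 : (#Z : ℝ) ≤ ∑ i ∈ range q, ((n : ℝ) - k - 1 - #(typical G q t W i) + k * a 2) := by
    calc (#Z : ℝ) = ∑ z ∈ Z, (1 : ℝ) := by simp
      _ ≤ ∑ z ∈ Z, ∑ i ∈ range q,
          (#(stableSets G k (nonNbrs G (W i) z)) : ℝ) / #(stableSets G k (W i)) :=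
        sum_le_sum fun z hz => h.one_le_sum_proportion (hZt z hz)
      _ = ∑ i ∈ range q, ∑ z ∈ Z,
          (#(stableSets G k (nonNbrs G (W i) z)) : ℝ) / #(stableSets G k (W i)) := sum_comm
      _ ≤ _ := sum_le_sum fun i hi => h.sum_proportion_le hB (mem_range.1 hi)
        (disjoint_left.2 fun z hz => hZt z hz i (mem_range.1 hi))
  have h3 : (Fintype.card V : ℝ) ≤ #Z + ∑ i ∈ range q, (#(typical G q t W i) : ℝ) := by
    exact_mod_cast h1
  have h4 : ∑ i ∈ range q, ((n : ℝ) - k - 1 - #(typical G q t W i) + k * a 2) =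
      q * (n - k - 1 + k * a 2) - ∑ i ∈ range q, (#(typical G q t W i) : ℝ) := by
    rw [sum_add_distrib, sum_sub_distrib, sum_const, sum_const, card_range, nsmul_eq_mul,
      nsmul_eq_mul]
    ring
  have h5 : (Fintype.card V : ℝ) + q * k + q ≤ q * n + q * (k * a 2) := by
    rw [h4] at h2
    linarith
  exact_mod_cast h5

end AlmostJoined

end Counting

/-! ### From missing copies to conditions on vertex sets -/

section Translation

variable {V : Type*} {G : SimpleGraph V}

theorem noParts_of_not_isContained {p : ℕ} {a : ℕ → ℕ}
    (h : ¬ (completePartite p a).IsContained G) : NoParts G p a := by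
  intro S hS hJ
  have hadj : ∀ i j : ℕ, i < p → j < p → i ≠ j → Joined G (S i) (S j) := by
    intro i j hi hj hij
    rcases lt_or_gt_of_ne hij with hlt | hlt
    · exact hJ i j hlt hj
    · exact (hJ j i hlt hi).symm
  let f : (Σ i : Fin p, Fin (a ((i : ℕ) + 1))) → V := fun x =>
    ((S x.1).equivFin.symm (Fin.castLE (hS x.1 x.1.2) x.2) : V)
  have hf : ∀ x, f x ∈ S x.1 := fun x => Subtype.property _
  have hne : ∀ x y, x.1 ≠ y.1 → G.Adj (f x) (f y) := fun x y hxy =>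
    hadj x.1 y.1 x.1.2 y.1.2 (fun he => hxy (Fin.ext he)) _ (hf x) _ (hf y)
  refine h ⟨⟨⟨f, fun {x y} hxy => hne x y ?_⟩, fun x y hxy => ?_⟩⟩
  · exact hxy
  · by_cases hi : x.1 = y.1
    · obtain ⟨i, x⟩ := x
      obtain ⟨j, y⟩ := y
      obtain rfl : i = j := hi
      have := Fin.castLE_injective _ ((S i).equivFin.symm.injective (Subtype.ext hxy))
      exact congrArg (Sigma.mk i) this
    · have := hne x y hi
      rw [show f x = f y from hxy] at this
      exact absurd this (G.loopless.irrefl _)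

theorem noBook_of_not_isContained [Fintype V] {k n : ℕ}
    (h : ¬ (bookGraph k n).IsContained Gᶜ) : NoBook G k n := by
  intro K hK hs
  by_contra hcon
  set C := univ.filter fun u => u ∉ K ∧ ∀ x ∈ K, ¬ G.Adj u x with hC
  have hle : ∀ i : Fin n, ¬ (i : ℕ) < k → (i : ℕ) - k < #C := fun i hi => by omega
  let f : Fin n → V := fun i =>
    if hi : (i : ℕ) < k then (K.equivFin.symm ⟨i, hK ▸ hi⟩ : V)
    else (C.equivFin.symm ⟨i - k, hle i hi⟩ : V)
  have hfK : ∀ i : Fin n, (i : ℕ) < k → f i ∈ K := fun i hi => by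
    simp only [f, dif_pos hi]; exact Subtype.property _
  have hfC : ∀ i : Fin n, ¬ (i : ℕ) < k → f i ∈ C := fun i hi => by
    simp only [f, dif_neg hi]; exact Subtype.property _
  have hinj : Function.Injective f := by
    intro i j hij
    by_cases hi : (i : ℕ) < k <;> by_cases hj : (j : ℕ) < k
    · simp only [f, dif_pos hi, dif_pos hj] at hij
      have := congrArg Fin.val (K.equivFin.symm.injective (Subtype.ext hij))
      exact Fin.ext this
    · exact absurd (hij ▸ hfK i hi) (mem_filter.1 (hfC j hj)).2.1
    · exact absurd (hij ▸ hfK j hj) (mem_filter.1 (hfC i hi)).2.1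
    · simp only [f, dif_neg hi, dif_neg hj] at hij
      have := congrArg Fin.val (C.equivFin.symm.injective (Subtype.ext hij))
      dsimp only at this
      exact Fin.ext (by omega)
  have hadj : ∀ i j : Fin n, (i : ℕ) < k → ¬ G.Adj (f i) (f j) := by
    intro i j hi
    by_cases hj : (j : ℕ) < k
    · exact hs _ (hfK i hi) _ (hfK j hj)
    · exact fun hc => (mem_filter.1 (hfC j hj)).2.2 _ (hfK i hi) hc.symm
  refine h ⟨⟨⟨f, fun {i j} hij => ?_⟩, hinj⟩⟩
  obtain ⟨hne, hk⟩ := hij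
  refine (SimpleGraph.compl_adj _ _ _).2 ⟨fun he => hne (hinj he), ?_⟩
  rcases hk with hk | hk
  · exact hadj i j hk
  · exact fun hc => hadj j i hk hc.symm

end Translation

/-! ### Explicit parameters and the upper bound -/

section Parameters

/-- The reciprocal of the density of edges from a vertex to a large set below which the vertex
counts as nonadjacent to the set. -/
def paramR (k t : ℕ) : ℕ := 2 * k * (8 * t) ^ k

/-- The reciprocal of the density of nonedges allowed between two of the large sets. -/
def paramM (q k t : ℕ) : ℕ := 4 * (q + 1) * t * paramR k t

/-- The reciprocal of the density of nonedges allowed between a cluster and a stable set. -/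
def paramL (q k t : ℕ) : ℕ := 16 * q * paramM q k t * (2 * q + 3) + 2 * (t + 1)

/-- The reciprocal of the proportion of vertices that may be neglected. -/
def paramE (q k t : ℕ) : ℕ := 8 * q ^ 2 * ((2 * paramL q k t) ^ k) ^ 2 * paramL q k t

/-- The size of the stable sets. -/
def paramT (q k t : ℕ) : ℕ := paramE q k t * (k * (t + k))

/-- The reciprocal of the proportion of vertices that the last part may have. -/
def paramD (q k t : ℕ) : ℕ :=
  4 * 2 ^ (q * (paramT q k t * (8 * q * k) ^ q)) *
    (paramT q k t * (8 * q * k) ^ q + 1) ^ (q * t) +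
  paramE q k t * 2 ^ (q * paramT q k t) + 16 * paramR k t

/-- The number of vertices exceeds the bound of `AlmostJoined.card_add_le` by exactly one. -/
theorem ramseyArrow_of_large {q k t n : ℕ} {a : ℕ → ℕ} (hq : 1 ≤ q) (hk : 1 ≤ k) (ht : 1 ≤ t)
    (hn : paramE q k t * q + 16 * paramR k t * (k * t) ≤ n) (ha1 : a 1 = 1) (ha2 : 1 ≤ a 2)
    (ha : ∀ i, 1 ≤ i → i ≤ q → a i ≤ t) (hb : 1 ≤ a (q + 1)) (hD : paramD q k t * a (q + 1) ≤ n) :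
    RamseyArrow (completePartite (q + 1) a) (bookGraph k n)
      (q * (n - 1) + k * q * (a 2 - 1) + 1) := by
  intro G
  by_contra hcon
  rw [not_or] at hcon
  have hNP := noParts_of_not_isContained hcon.1
  have hNB := noBook_of_not_isContained hcon.2
  have hNJ : NoJoined G q t (a (q + 1)) := hNP.noJoined ha
  have hsplit : paramD q k t * a (q + 1) =
      4 * 2 ^ (q * (paramT q k t * (8 * q * k) ^ q)) *
        ((paramT q k t * (8 * q * k) ^ q + 1) ^ (q * t) * a (q + 1)) +
      paramE q k t * (2 ^ (q * paramT q k t) * a (q + 1)) + 16 * paramR k t * a (q + 1) := by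
    rw [paramD]; ring
  rw [hsplit] at hD
  have hRk : k ≤ 16 * paramR k t := by
    have : 1 ≤ (8 * t) ^ k := Nat.one_le_pow _ _ (by omega)
    calc k = 1 * (1 * k * 1) := by ring
      _ ≤ 16 * (2 * k * (8 * t) ^ k) := by gcongr <;> norm_num
  have hRpos : 1 ≤ paramR k t := by
    rw [paramR]
    exact Nat.mul_pos (by omega) (Nat.pow_pos (by omega))
  have hka2 : k * a 2 ≤ n := by
    have hb' : ∀ c, c ≤ t ∨ c = a (q + 1) → k * c ≤ n := by
      rintro c (hc | rfl)
      · calc k * c ≤ k * t := by gcongr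
          _ = 1 * (k * t) := by ring
          _ ≤ 16 * paramR k t * (k * t) := by gcongr; omega
          _ ≤ n := by omega
      · calc k * a (q + 1) ≤ 16 * paramR k t * a (q + 1) := by gcongr
          _ ≤ n := by omega
    apply hb'
    -- For q = 1 the size `a 2` is the last one and is bounded through `paramD` instead of t.
    rcases Nat.lt_or_ge q 2 with h | h
    · right; congr 1; omega
    · left; exact ha 2 (by omega) h
  have hcardeq : k * q * (a 2 - 1) + k * q = q * (k * a 2) := by
    obtain ⟨c, hc⟩ : ∃ c, a 2 = c + 1 := ⟨a 2 - 1, by omega⟩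
    rw [hc, Nat.add_sub_cancel]; ring
  have hkt : 1 ≤ k * t := Nat.mul_pos hk ht
  have hn1 : 1 ≤ n := by
    have : 1 * 1 * 1 ≤ 16 * paramR k t * (k * t) := by gcongr; norm_num
    omega
  have hqn : q * (n - 1) + q = q * n := by
    obtain ⟨c, hc⟩ : ∃ c, n = c + 1 := ⟨n - 1, by omega⟩
    rw [hc, Nat.add_sub_cancel]; ring
  have hcard := Fintype.card_fin (q * (n - 1) + k * q * (a 2 - 1) + 1)
  have hP : Params q k t (a (q + 1)) n
      (Fintype.card (Fin (q * (n - 1) + k * q * (a 2 - 1) + 1)))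
      (paramM q k t) (paramL q k t) (paramE q k t) (paramT q k t) :=
    { one_le_q := hq
      one_le_k := hk
      one_le_t := ht
      b_pos := hb
      one_le_M := by
        rw [paramM]
        exact Nat.mul_pos (Nat.mul_pos (by omega) ht) hRpos
      L_ge := Nat.le_add_right _ _
      L_ge' := Nat.le_add_left _ _
      E_ge := le_rfl
      T_eq := rfl
      n_ge := by omega
      N_ge := by rw [hcard]; omega
      N_le := by
        rw [hcard]
        have h1 : q * (k * a 2) ≤ q * n := Nat.mul_le_mul_left _ hka2
        have h2 : 2 * (q + 1) * n = 2 * (q * n) + 2 * n := by ring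
        omega
      n_ge_mul_b := by omega
      n_ge_mul_b' := by omega }
  have h4q : 4 * q ≤ n := by
    have h1 := hP.E_ge_L
    have h2 := hP.L_pos
    have h3 : 4 * q ≤ paramE q k t * q := by gcongr; omega
    omega
  obtain ⟨Q, hQ, hQQ⟩ := exists_joined_stable_family hNB hNJ hb hk (s := paramT q k t)
    ((Nat.le_add_left k t).trans hP.add_le_T) hP.N_ge h4q hP.n_ge_mul_b
  have hQJ : JoinedStable G q (paramT q k t) Q :=
    ⟨fun i hi => (hQ i hi).1, fun i hi => (hQ i hi).2, fun i j hij hi hj => by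
      rcases lt_or_gt_of_ne hij with hlt | hlt
      · exact hQQ i j hlt hj
      · exact (hQQ j i hlt hi).symm⟩
  obtain ⟨W, hW, hWW⟩ := hP.exists_almost_joined_family hNB hNJ hQJ
  have hA : AlmostJoined G q t k n (paramR k t) a W :=
    { noParts := hNP
      one_le_q := hq
      one_le_t := ht
      one_le_k := hk
      a_one := ha1
      one_le_a := ha2
      a_le := ha
      R_eq := rfl
      n_ge_mul_a := by omega
      n_ge_mul_t := by omega
      n_le := hW
      card_nonNbrs := hWW }
  have := hA.card_add_le hNB
  rw [hcard, mul_comm q k] at this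
  omega

end Parameters

/-! ### Functions bounded by boundedly many exponentials -/

section IteratedExp

theorem iteratedExp_mono {h h' : ℕ} (hh : h ≤ h') (m : ℕ) :
    iteratedExp h m ≤ iteratedExp h' m := by
  induction hh with
  | refl => exact le_rfl
  | step _ ih => exact ih.trans Nat.lt_two_pow_self.le

theorem le_iteratedExp (h m : ℕ) : h ≤ iteratedExp h m := by
  induction h with
  | zero => exact Nat.zero_le _
  | succ h ih => exact ih.trans_lt Nat.lt_two_pow_self

/-- The function is bounded by a fixed number of iterated exponentials. -/
def Elementary (f : ℕ → ℕ → ℕ → ℕ) : Prop :=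
  ∃ h, ∀ k p t, 2 ≤ k → 2 ≤ p → 2 ≤ t → f k p t ≤ iteratedExp h (k + p + t)

namespace Elementary

variable {f g : ℕ → ℕ → ℕ → ℕ}

theorem const (c : ℕ) : Elementary fun _ _ _ => c :=
  ⟨c, fun _ _ _ _ _ _ => le_iteratedExp _ _⟩

theorem of_le_add (hf : ∀ k p t, f k p t ≤ k + p + t) : Elementary f :=
  ⟨0, fun k p t _ _ _ => hf k p t⟩

/-- A common height for both functions; the bound 4 is what `sq_le_two_pow` needs. -/
theorem common (hf : Elementary f) (hg : Elementary g) :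
    ∃ h, ∀ k p t, 2 ≤ k → 2 ≤ p → 2 ≤ t → f k p t ≤ iteratedExp h (k + p + t) ∧
      g k p t ≤ iteratedExp h (k + p + t) ∧ 4 ≤ iteratedExp h (k + p + t) := by
  obtain ⟨h1, hf⟩ := hf
  obtain ⟨h2, hg⟩ := hg
  refine ⟨h1 + h2, fun k p t hk hp ht => ⟨(hf k p t hk hp ht).trans (iteratedExp_mono (by omega) _),
    (hg k p t hk hp ht).trans (iteratedExp_mono (by omega) _), ?_⟩⟩
  have h3 : k + p + t ≤ iteratedExp (h1 + h2) (k + p + t) :=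
    iteratedExp_mono (Nat.zero_le _) (k + p + t)
  omega

theorem sq_le_two_pow {x : ℕ} (hx : 4 ≤ x) : x * x ≤ 2 ^ x := by
  induction x, hx using Nat.le_induction with
  | base => norm_num
  | succ x hx ih => rw [pow_succ]; nlinarith

theorem add (hf : Elementary f) (hg : Elementary g) :
    Elementary fun k p t => f k p t + g k p t := by
  obtain ⟨h, hh⟩ := common hf hg
  refine ⟨h + 1, fun k p t hk hp ht => ?_⟩
  obtain ⟨h1, h2, h3⟩ := hh k p t hk hp ht
  refine le_trans ?_ (sq_le_two_pow h3)
  nlinarith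

theorem mul (hf : Elementary f) (hg : Elementary g) :
    Elementary fun k p t => f k p t * g k p t := by
  obtain ⟨h, hh⟩ := common hf hg
  refine ⟨h + 1, fun k p t hk hp ht => ?_⟩
  obtain ⟨h1, h2, h3⟩ := hh k p t hk hp ht
  exact (Nat.mul_le_mul h1 h2).trans (sq_le_two_pow h3)

theorem pow (hf : Elementary f) (hg : Elementary g) :
    Elementary fun k p t => f k p t ^ g k p t := by
  obtain ⟨h, hh⟩ := common hf hg
  refine ⟨h + 2, fun k p t hk hp ht => ?_⟩
  obtain ⟨h1, h2, h3⟩ := hh k p t hk hp ht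
  set x := iteratedExp h (k + p + t) with hx
  calc f k p t ^ g k p t ≤ x ^ g k p t := Nat.pow_le_pow_left h1 _
    _ ≤ x ^ x := Nat.pow_le_pow_right (by omega) h2
    _ ≤ (2 ^ x) ^ x := Nat.pow_le_pow_left Nat.lt_two_pow_self.le _
    _ = 2 ^ (x * x) := (pow_mul _ _ _).symm
    _ ≤ 2 ^ (2 ^ x) := Nat.pow_le_pow_right (by norm_num) (sq_le_two_pow h3)

end Elementary

open Elementary in
-- The parameter arises from k, p - 1, t and constants by a fixed number of sums, products and
-- powers, each of which costs at most two further exponentials.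
theorem elementary_paramD : Elementary fun k p t => paramD (p - 1) k t := by
  have hk : Elementary fun k _ _ => k := of_le_add fun _ _ _ => by omega
  have hq : Elementary fun _ p _ => p - 1 := of_le_add fun _ _ _ => by omega
  have ht : Elementary fun _ _ t => t := of_le_add fun _ _ _ => by omega
  have hR : Elementary fun k _ t => paramR k t :=
    ((const 2).mul hk).mul (((const 8).mul ht).pow hk)
  have hM : Elementary fun k p t => paramM (p - 1) k t :=
    (((const 4).mul (hq.add (const 1))).mul ht).mul hR
  have hL : Elementary fun k p t => paramL (p - 1) k t :=
    ((((const 16).mul hq).mul hM).mul (((const 2).mul hq).add (const 3))).add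
      ((const 2).mul (ht.add (const 1)))
  have hE : Elementary fun k p t => paramE (p - 1) k t :=
    (((const 8).mul (hq.pow (const 2))).mul ((((const 2).mul hL).pow hk).pow (const 2))).mul hL
  have hT : Elementary fun k p t => paramT (p - 1) k t := hE.mul (hk.mul (ht.add hk))
  have hTm := hT.mul ((((const 8).mul hq).mul hk).pow hq)
  exact ((((const 4).mul ((const 2).pow (hq.mul hTm))).mul
    ((hTm.add (const 1)).pow (hq.mul ht))).add (hE.mul ((const 2).pow (hq.mul hT)))).add
      ((const 16).mul hR)

end IteratedExp

/-! ### The extremal construction -/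

section LowerBound

/-- Disjoint cliques on `d` vertices, arranged into blocks of `m` vertices, with all edges between
different blocks. -/
def blockGraph (N m d : ℕ) : SimpleGraph (Fin N) where
  Adj u v := u ≠ v ∧ ((u : ℕ) / m ≠ v / m ∨ (u : ℕ) / d = v / d)
  symm := ⟨fun _ _ h => ⟨h.1.symm, h.2.imp Ne.symm Eq.symm⟩⟩
  loopless := ⟨fun _ h => h.1 rfl⟩

/-- Take one vertex of the first part and d of each other part. Two of these q * d + 1 vertices in
one block and in different parts lie in one clique. Some block receives d + 1 of them, not all from
one part, and this forces all of them into a single clique on d vertices. -/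
theorem not_isContained_blockGraph {q N m d : ℕ} {a : ℕ → ℕ} (hd : 0 < d) (hN : N ≤ q * m)
    (ha1 : 1 ≤ a 1) (ha : ∀ i, 2 ≤ i → i ≤ q + 1 → d ≤ a i) :
    ¬ (completePartite (q + 1) a).IsContained (blockGraph N m d) := by
  rintro ⟨f⟩
  have hm : ∀ u : Fin N, (u : ℕ) / m < q := fun u =>
    Nat.div_lt_of_lt_mul (lt_of_lt_of_le u.2 (by rwa [mul_comm]))
  let v : Option (Fin q × Fin d) → Σ i : Fin (q + 1), Fin (a ((i : ℕ) + 1)) := fun x =>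
    x.elim ⟨0, ⟨0, ha1⟩⟩ fun y =>
      ⟨y.1.succ, Fin.castLE (ha _ (by simp) (by simp only [Fin.val_succ]; omega)) y.2⟩
  -- The position within the part; it takes d values, so at most d chosen vertices share a part.
  let r : Option (Fin q × Fin d) → ℕ := fun x => x.elim 0 fun y => y.2
  have hr : ∀ x, r x < d := by
    rintro (_ | ⟨i, y⟩)
    · exact hd
    · exact y.2
  have hvr : ∀ x y, (v x).1 = (v y).1 → r x = r y → x = y := by
    rintro (_ | ⟨i, x⟩) (_ | ⟨j, y⟩) h1 h2
    · rfl
    · exact absurd h1.symm (Fin.succ_ne_zero _)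
    · exact absurd h1 (Fin.succ_ne_zero _)
    · have h3 : i = j := Fin.succ_injective _ h1
      have h4 : x = y := Fin.ext h2
      rw [h3, h4]
  have hv : Function.Injective v := fun x y hxy => hvr x y (by rw [hxy]) (by
    rcases x with _ | ⟨i, x⟩ <;> rcases y with _ | ⟨j, y⟩
    · rfl
    · exact absurd (congrArg Sigma.fst hxy).symm (Fin.succ_ne_zero _)
    · exact absurd (congrArg Sigma.fst hxy) (Fin.succ_ne_zero _)
    · obtain rfl : i = j := Fin.succ_injective _ (congrArg Sigma.fst hxy)
      have := eq_of_heq (Sigma.mk.inj hxy).2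
      exact congrArg (fun z : Fin (a (((Fin.succ i : Fin (q + 1)) : ℕ) + 1)) => (z : ℕ)) this)
  let g : Option (Fin q × Fin d) → ℕ := fun x => (f (v x) : ℕ)
  have hg : Function.Injective g := fun x y hxy => hv (f.injective (Fin.ext hxy))
  obtain ⟨b, -, hb⟩ := exists_lt_card_fiber_of_mul_lt_card_of_maps_to (s := univ) (t := range q)
    (f := fun x => g x / m) (n := d) (fun x _ => mem_range.2 (hm _))
    (by rw [card_range, card_univ, Fintype.card_option, Fintype.card_prod, Fintype.card_fin,
      Fintype.card_fin]; omega)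
  set F := univ.filter fun x => g x / m = b with hF
  have hsame : ∀ x ∈ F, ∀ y ∈ F, (v x).1 ≠ (v y).1 → g x / d = g y / d := by
    intro x hx y hy hxy
    have hadj : (blockGraph N m d).Adj (f (v x)) (f (v y)) := f.toHom.map_rel hxy
    refine hadj.2.resolve_left fun hne => hne ?_
    exact (mem_filter.1 hx).2.trans (mem_filter.1 hy).2.symm
  have hother : ∀ i, ∃ y ∈ F, (v y).1 ≠ i := by
    intro i
    by_contra hcon
    push Not at hcon
    have := card_le_card_of_injOn (s := F) (t := range d) r
      (fun x _ => mem_coe.2 (mem_range.2 (hr x)))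
      (fun x hx y hy hxy => hvr x y ((hcon x hx).trans (hcon y hy).symm) hxy)
    rw [card_range] at this
    omega
  obtain ⟨x, hx, -⟩ := hother 0
  obtain ⟨y, hy, hyx⟩ := hother (v x).1
  have hall : ∀ z ∈ F, g z / d = g x / d := by
    intro z hz
    by_cases hzx : (v z).1 = (v x).1
    · rw [hsame z hz y hy (hzx ▸ hyx.symm), hsame y hy x hx hyx]
    · exact hsame z hz x hx hzx
  have := card_le_card_of_injOn (s := F) (t := range d) (fun z => g z % d)
    (fun z _ => mem_coe.2 (mem_range.2 (Nat.mod_lt _ hd))) (fun z hz w hw hzw => hg (by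
      rw [← Nat.div_add_mod (g z) d, ← Nat.div_add_mod (g w) d, hall z hz, hall w hw]
      exact congrArg _ hzw))
  rw [card_range] at this
  omega

/-- A book in the complement lies in one block. Its spine meets k different cliques and its n - k
pages avoid them, so the block would need n - k + k * d = m + 1 vertices. -/
theorem not_isContained_compl_blockGraph {k n N m d : ℕ} (hk : 1 ≤ k) (hkn : k < n) (hd : 0 < d)
    (hdm : d ∣ m) (hm : m + 1 + k = n + k * d) :
    ¬ (bookGraph k n).IsContained (blockGraph N m d)ᶜ := by
  rintro ⟨f⟩
  let g : Fin n → ℕ := fun i => (f i : ℕ)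
  have hg : Function.Injective g := fun x y hxy => f.injective (Fin.ext hxy)
  have hadj : ∀ i j : Fin n, i ≠ j → (i : ℕ) < k → g i / m = g j / m ∧ g i / d ≠ g j / d := by
    intro i j hij hi
    have h1 : (blockGraph N m d)ᶜ.Adj (f i) (f j) := f.toHom.map_rel ⟨hij, Or.inl hi⟩
    obtain ⟨h2, h3⟩ := (SimpleGraph.compl_adj _ _ _).1 h1
    have h4 : ¬ (g i / m ≠ g j / m ∨ g i / d = g j / d) := fun h => h3 ⟨h2, h⟩
    rw [not_or, not_not] at h4
    exact h4
  have hkd : k ≤ k * d := Nat.le_mul_of_pos_right _ hd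
  have hm0 : 0 < m := by omega
  let o : Fin n := ⟨0, by omega⟩
  have hblock : ∀ i, g i / m = g o / m := by
    intro i
    by_cases hi : i = o
    · rw [hi]
    · exact (hadj o i (Ne.symm hi) hk).1.symm
  obtain ⟨c, hc⟩ := hdm
  -- As d divides m, no clique straddles two blocks.
  have hdiv : ∀ x, x / m = x / d / c := fun x => by rw [hc, Nat.div_div_eq_div_mul]
  -- The block is taken in `ℕ`, because N may cut off part of it or of a clique.
  set I := (range (g o / m * m + m)).filter fun x => x / m = g o / m with hI
  have hmem : ∀ x, x / m = g o / m → x ∈ I := fun x hx =>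
    mem_filter.2 ⟨mem_range.2 (by
      rw [← hx]
      have := Nat.div_add_mod x m
      have := Nat.mod_lt x hm0
      rw [mul_comm]; omega), hx⟩
  have hIc : #I ≤ m := by
    have := card_le_card_of_injOn (s := I) (t := range m) (fun x => x % m)
      (fun x _ => mem_coe.2 (mem_range.2 (Nat.mod_lt _ hm0))) (fun x hx y hy hxy => by
        rw [← Nat.div_add_mod x m, ← Nat.div_add_mod y m, (mem_filter.1 hx).2, (mem_filter.1 hy).2]
        exact congrArg _ hxy)
    rwa [card_range] at this
  let s : Fin k × Fin d → ℕ := fun x => g (Fin.castLE hkn.le x.1) / d * d + x.2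
  have hsd : ∀ x, s x / d = g (Fin.castLE hkn.le x.1) / d := fun x => by
    simp only [s]
    rw [mul_comm, Nat.mul_add_div hd, Nat.div_eq_of_lt x.2.2, add_zero]
  have hsinj : Function.Injective s := by
    rintro ⟨i, x⟩ ⟨j, y⟩ hxy
    have h1 : g (Fin.castLE hkn.le i) / d = g (Fin.castLE hkn.le j) / d := by
      rw [← hsd (i, x), ← hsd (j, y), hxy]
    have h2 : i = j := by
      by_contra hij
      exact (hadj (Fin.castLE hkn.le i) (Fin.castLE hkn.le j)
        (fun h => hij (Fin.castLE_injective _ h)) i.2).2 h1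
    subst h2
    have h3 : (x : ℕ) = y := Nat.add_left_cancel hxy
    rw [Fin.ext h3]
  set A := (univ.filter fun i : Fin n => k ≤ (i : ℕ)).image g with hA
  set B := (univ : Finset (Fin k × Fin d)).image s with hB
  have hAc : #A = n - k := by
    rw [hA, card_image_of_injective _ hg]
    have h1 : (univ.filter fun i : Fin n => k ≤ (i : ℕ)) = Finset.Ici ⟨k, hkn⟩ := by
      ext i; simp [Fin.le_def]
    rw [h1, Fin.card_Ici]
  have hBc : #B = k * d := by
    rw [hB, card_image_of_injective _ hsinj, card_univ, Fintype.card_prod, Fintype.card_fin,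
      Fintype.card_fin]
  have hAB : Disjoint A B := by
    rw [disjoint_left]
    intro x hxA hxB
    obtain ⟨i, hi, rfl⟩ := mem_image.1 hxA
    obtain ⟨y, -, hy⟩ := mem_image.1 hxB
    have hi := (mem_filter.1 hi).2
    have h1 := hsd y
    rw [hy] at h1
    refine (hadj (Fin.castLE hkn.le y.1) i (fun h => ?_) y.1.2).2 h1.symm
    have := congrArg Fin.val h
    have := y.1.2
    simp only [Fin.val_castLE] at *
    omega
  have hsub : A ∪ B ⊆ I := by
    refine union_subset (fun x hx => ?_) (fun x hx => ?_)
    · obtain ⟨i, -, rfl⟩ := mem_image.1 hx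
      exact hmem _ (hblock i)
    · obtain ⟨y, -, rfl⟩ := mem_image.1 hx
      refine hmem _ ?_
      rw [hdiv, hsd, ← hdiv]
      exact hblock _
  have := (card_le_card hsub).trans hIc
  rw [card_union_of_disjoint hAB, hAc, hBc] at this
  omega

end LowerBound

end BookRamsey

/-! ### The theorem -/

theorem mainTheorem1 :
    -- a fixed number `h` of exponentials bounds `1 / δ` in terms of `k, p, t`
    ∃ h : ℕ, ∀ k p t : ℕ, 2 ≤ k → 2 ≤ p → 2 ≤ t →
      ∃ δ : ℝ, 0 < δ ∧ 1 / δ ≤ (iteratedExp h (k + p + t) : ℝ) ∧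
        ∃ n₀ : ℕ, ∀ n : ℕ, n₀ ≤ n → ∀ a : ℕ → ℕ,
          a 1 = 1 →
          (∀ i j : ℕ, 1 ≤ i → i ≤ j → j ≤ p - 1 → a i ≤ a j) →
          a (p - 1) ≤ t →
          1 ≤ a p →
          (a p : ℝ) ≤ δ * (n : ℝ) →
          ramseyNumber (completePartite p a) (bookGraph k n) ≤
              (((p - 1) * (n - 1) + k * (p - 1) * (a 2 - 1) + 1 : ℕ) : ℕ∞) ∧
            (a 2 ≤ a p → (a 2 : ℤ) ∣ (n : ℤ) - 1 - (k : ℤ) →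
              ramseyNumber (completePartite p a) (bookGraph k n) =
                (((p - 1) * (n - 1) + k * (p - 1) * (a 2 - 1) + 1 : ℕ) : ℕ∞)) := by
  obtain ⟨h, hh⟩ := BookRamsey.elementary_paramD
  refine ⟨h, fun k p t hk hp ht => ?_⟩
  obtain ⟨q, rfl⟩ : ∃ q, p = q + 1 := ⟨p - 1, by omega⟩
  have hD := hh k (q + 1) t hk hp ht
  simp only [Nat.add_sub_cancel] at hD ⊢
  have hDpos : 0 < BookRamsey.paramD q k t := by
    have : 0 < 16 * BookRamsey.paramR k t :=
      Nat.mul_pos (by norm_num) (Nat.mul_pos (by omega) (Nat.pow_pos (by omega)))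
    exact Nat.lt_of_lt_of_le this (Nat.le_add_left _ _)
  have hDpos' : (0 : ℝ) < BookRamsey.paramD q k t := by exact_mod_cast hDpos
  refine ⟨1 / BookRamsey.paramD q k t, by positivity, ?_,
    BookRamsey.paramE q k t * q + 16 * BookRamsey.paramR k t * (k * t) + k + 1, ?_⟩
  · rw [one_div_one_div]
    exact_mod_cast hD
  intro n hn a ha1 hmono hat hap hδ
  have haD : BookRamsey.paramD q k t * a (q + 1) ≤ n := by
    rw [one_div, inv_mul_eq_div, le_div_iff₀ hDpos'] at hδ
    have : a (q + 1) * BookRamsey.paramD q k t ≤ n := by exact_mod_cast hδ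
    rwa [mul_comm]
  have ha2 : 1 ≤ a 2 := by
    rcases Nat.lt_or_ge q 2 with h1 | h1
    · obtain rfl : q = 1 := by omega
      exact hap
    · rw [← ha1]; exact hmono 1 2 le_rfl (by omega) h1
  have hupper : ramseyNumber (completePartite (q + 1) a) (bookGraph k n) ≤
      ((q * (n - 1) + k * q * (a 2 - 1) + 1 : ℕ) : ℕ∞) :=
    iInf₂_le _ (BookRamsey.ramseyArrow_of_large (by omega) (by omega) (by omega) (by omega) ha1 ha2
      (fun i h1 hi => (hmono i q h1 hi le_rfl).trans hat) hap haD)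
  refine ⟨hupper, fun h2p hdvd => le_antisymm hupper (le_iInf₂ fun N hN => ?_)⟩
  by_contra hcon
  have hlt : N < q * (n - 1) + k * q * (a 2 - 1) + 1 := by
    rw [not_le] at hcon
    exact_mod_cast hcon
  have hdvd' : a 2 ∣ n - 1 - k := by
    have : ((n - 1 - k : ℕ) : ℤ) = (n : ℤ) - 1 - k := by omega
    rw [← this] at hdvd
    exact_mod_cast hdvd
  obtain ⟨c, hc⟩ : ∃ c, a 2 = c + 1 := ⟨a 2 - 1, by omega⟩
  have hkc : k * (c + 1) = k * c + k := by ring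
  -- With blocks of this size, q blocks have exactly one vertex fewer than the claimed Ramsey
  -- number, so they accommodate every smaller N.
  have hm : n - 1 - k + k * a 2 = n - 1 + k * c := by rw [hc, hkc]; omega
  rcases hN (BookRamsey.blockGraph N (n - 1 - k + k * a 2) (a 2)) with hcopy | hcopy
  · refine BookRamsey.not_isContained_blockGraph (by omega) ?_ ha1.ge (fun i h1 hi => ?_) hcopy
    · rw [hm]
      rw [hc, Nat.add_sub_cancel] at hlt
      have : q * (n - 1 + k * c) = q * (n - 1) + k * q * c := by ring
      omega
    · rcases Nat.lt_or_ge q i with h3 | h3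
      · obtain rfl : i = q + 1 := by omega
        exact h2p
      · exact hmono 2 i (by norm_num) h1 h3
  · exact BookRamsey.not_isContained_compl_blockGraph (by omega) (by omega) (by omega)
      (hdvd'.add (Dvd.intro_left _ rfl)) (by omega) hcopy
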